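/- Let $y_1,y_2,\dots$ be bits and write $y_a^b=(y_a,\dots,y_b)$. A (randomized) prediction strategy is a sequence $g=(g_n)_{n\ge1}$ of functions $g_n:\{0,1\}^{n-1}\times[0,1]\to\{0,1\}$; with $U_1,U_2,\dots$ i.i.d. uniform on $[0,1]$, its average number of mistakes between times $m$ and $n$ is \[ L_m^n(g)=L_m^n(g,U_m^n)=\frac1{n-m+1}\sum_{i=m}^n I_{\{g_i(y_1^{i-1},U_i)\ne y_i\}}, \] and $\widehat L_m^n(g)=\mathbf E\,L_m^n(g,U_m^n)$ denotes its expectation over the $U_i$ for a fixed sequence $y$. (For nonrandomized strategies the argument $U_i$ is dropped.) For $k\ge1$ the $k$-th order empirical Markov expert $h^{(k)}$ is the nonrandomized strategy given by $h^{(k)}_n(y_1^{n-1})=0$ if $\widehat P_n^k(0,y_1^{n-1},y_{n-k}^{n-1})>\frac12$ and $h^{(k)}_n(y_1^{n-1})=1$ otherwise, where for $n>k+1$ \[ \widehat P_n^k(b,y_1^{n-1},s)=\frac{|\{k<i<n:\ y_{i-k}^{i-1}=s,\ y_i=b\}|}{|\{k<i<n:\ y_{i-k}^{i-1}=s\}|}\qquad(0/0:=\tfrac12),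 \] and $\widehat P_n^k:=\frac12$ for $n\le k+1$. The predictor $g$ is defined as follows. For $m\ge 0$ and $2^m\le n<2^{m+1}$, put $\eta_m=\sqrt{8\ln(2^{m+1})/2^m}$, $w_{2^m}(k)=1$, $w_n(k)=e^{-\eta_m(n-2^m)L_{2^m}^{n-1}(h^{(k)})}$ for $2^m<n<2^{m+1}$, and \[ g_n(y_1^{n-1},u)=0\quad\text{if}\quad u>\frac{\sum_{k=1}^{2^{m+1}}h^{(k)}_n(y_1^{n-1})\,w_n(k)}{\sum_{k=1}^{2^{m+1}}w_n(k)},\qquad g_n(y_1^{n-1},u)=1\quad\text{otherwise}. \] Theorem. (i) The predictor $g$ is universal: for every stationary and ergodic binary process $\{Y_n\}_{n\in\mathbb Z}$ and i.i.d. uniform $U_1,U_2,\dots$ independent of it, the loss of $g$ on $Y_1,Y_2,\dots$ satisfies \[ \lim_{n\to\infty}L_1^n(g)=L^*:=\mathbf E\Big[\min\big(\mathbf P\{Y_0=1\mid Y_{-\infty}^{-1}\},\ \mathbf P\{Y_0=0\mid Y_{-\infty}^{-1}\}\big)\Big]\qquad\text{almost surely.} \] (ii) For every individual binary sequence $y_1,y_2,\dots$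 and every $n\ge1$, \[ \widehat L_1^n(g)\le\min_{k=1,2,\dots}L_1^n(h^{(k)})+c\sqrt{\frac{\log_2 n+1}{n}},\qquad c=\frac{\sqrt{\ln 2}}{\sqrt2-1}\approx2.01 . \] -/

import Mathlib

open MeasureTheory ProbabilityTheory Filter Topology

universe u

noncomputable section

namespace SeqPred

/-- `Past n` is the set of strings `y_1^{n-1} = (y_1, …, y_{n-1})`, the bits known before round `n`.
The bit `0` is `false` and the bit `1` is `true`. -/
abbrev Past (n : ℕ) : Type := Set.Ico 1 n → Bool

/-- A randomized prediction strategy: functions `g_n : {0,1}^{n-1} × [0,1] → {0,1}` for the rounds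
`n = 1, 2, …` (the index `n = 0` is never used). -/
abbrev Strategy : Type := ∀ n : ℕ, Past n → unitInterval → Bool

/-- A nonrandomized prediction strategy: functions `h_n : {0,1}^{n-1} → {0,1}`. -/
abbrev DetStrategy : Type := ∀ n : ℕ, Past n → Bool

/-- The string `y_1^{n-1}` cut out of an infinite sequence `y_1, y_2, …`
(the value `y 0` is never used). -/
def past (y : ℕ → Bool) (n : ℕ) : Past n := fun j => y j

/-- The initial string `y_1^{i-1}` of `y_1^{n-1}`, for `i ≤ n`. -/
def Past.init {n : ℕ} (y : Past n) (i : ℕ) (hi : i ≤ n) : Past i :=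
  fun j => y ⟨j, j.2.1, lt_of_lt_of_le j.2.2 hi⟩

/-- The block `y_{i-k}^{i-1} = (y_{i-k}, …, y_{i-1})` of length `k`, for `k < i ≤ n`. -/
def Past.block {n : ℕ} (y : Past n) (k i : ℕ) (hk : k < i) (hi : i ≤ n) : Fin k → Bool :=
  fun j => y ⟨i - k + j, by have := j.2; omega, by have := j.2; omega⟩

/-- The average number of mistakes that the guesses `guess i` make on `y`
between the times `m` and `n`. -/
def avgMistakes (guess y : ℕ → Bool) (m n : ℕ) : ℝ :=
  (∑ i ∈ Finset.Icc m n, if guess i ≠ y i then (1 : ℝ) else 0) / ((n : ℝ) - m + 1)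

/-- The loss `L_m^n(g, u_m^n)` of a randomized strategy on the sequence `y`. -/
def loss (g : Strategy) (y : ℕ → Bool) (u : ℕ → unitInterval) (m n : ℕ) : ℝ :=
  avgMistakes (fun i => g i (past y i) (u i)) y m n

/-- The loss `L_m^n(h)` of a nonrandomized strategy on the sequence `y`. -/
def detLoss (h : DetStrategy) (y : ℕ → Bool) (m n : ℕ) : ℝ :=
  avgMistakes (fun i => h i (past y i)) y m n

/-- The expected loss of a randomized strategy on a fixed sequence `y`, the expectation being over
independent randomizing variables with uniform distribution on `[0,1]`. -/
def expectedLoss (g : Strategy) (y : ℕ → Bool) (m n : ℕ) : ℝ :=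
  ∫ u, loss g y u m n ∂(Measure.infinitePi fun _ : ℕ => (volume : Measure unitInterval))

/-! ### The empirical Markov experts -/

/-- `|{k < i < n : y_{i-k}^{i-1} = s}|` -/
def countBlock {n : ℕ} (k : ℕ) (y : Past n) (s : Fin k → Bool) : ℕ :=
  (Finset.univ.filter fun i : Set.Ico 1 n =>
    ∃ hk : k < (i : ℕ), y.block k i hk i.2.2.le = s).card

/-- `|{k < i < n : y_{i-k}^{i-1} = s, y_i = b}|` -/
def countBlockBit {n : ℕ} (k : ℕ) (b : Bool) (y : Past n) (s : Fin k → Bool) : ℕ :=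
  (Finset.univ.filter fun i : Set.Ico 1 n =>
    (∃ hk : k < (i : ℕ), y.block k i hk i.2.2.le = s) ∧ y i = b).card

/-- The proportion of the bit `b` following the string `s` among all appearances of `s` in
`y_1^{n-1}`; it is `1/2` if `n ≤ k + 1` or if there is no such appearance. -/
def freq {n : ℕ} (k : ℕ) (b : Bool) (y : Past n) (s : Fin k → Bool) : ℝ :=
  if k + 1 < n ∧ countBlock k y s ≠ 0 then
    (countBlockBit k b y s : ℝ) / (countBlock k y s : ℝ)
  else 1 / 2

/-- The `k`-th order empirical Markov expert `h^{(k)}`. It predicts `0` if the relative frequency of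
`0` after the last seen block `y_{n-k}^{n-1}` exceeds `1/2`, and `1` otherwise (in particular
when `n ≤ k`, where there is no such block and all relative frequencies are `1/2`). -/
def expert (k : ℕ) : DetStrategy := fun n y =>
  if hk : k < n then
    if freq k false y (y.block k n hk le_rfl) > 1 / 2 then false else true
  else true

/-! ### The predictor -/

/-- The number `(n - a) L_a^{n-1}(h)` of mistakes of `h` at the times `a, …, n - 1`. -/
def mistakesFrom (h : DetStrategy) (a : ℕ) {n : ℕ} (y : Past n) : ℕ :=
  (Finset.univ.filter fun i : Set.Ico 1 n =>
    a ≤ (i : ℕ) ∧ h i (y.init i i.2.2.le) ≠ y i).card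

/-- `η_m = √(8 ln(2^{m+1}) / 2^m)` -/
def eta (m : ℕ) : ℝ := Real.sqrt (8 * Real.log (2 ^ (m + 1)) / 2 ^ m)

/-- The weight `w_n(k)` of the expert `h^{(k)}` for `2^m ≤ n < 2^{m+1}`, that is,
`m = ⌊log₂ n⌋`. It is `1` for `n = 2^m`. -/
def weight {n : ℕ} (y : Past n) (k : ℕ) : ℝ :=
  Real.exp (-eta (Nat.log 2 n) * (mistakesFrom (expert k) (2 ^ Nat.log 2 n) y : ℝ))

/-- The prediction strategy `g`: an exponentially weighted majority vote over the experts
`h^{(1)}, …, h^{(2^{m+1})}` for `2^m ≤ n < 2^{m+1}`. -/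
def predictor : Strategy := fun n y u =>
  if (u : ℝ) >
      (∑ k ∈ Finset.Icc 1 (2 ^ (Nat.log 2 n + 1)),
        (if expert k n y = true then (1 : ℝ) else 0) * weight y k) /
      (∑ k ∈ Finset.Icc 1 (2 ^ (Nat.log 2 n + 1)), weight y k)
  then false else true

/-! ### Stationary ergodic processes and universality -/

/-- The left shift on doubly infinite binary sequences. -/
def shift (x : ℤ → Bool) : ℤ → Bool := fun i => x (i + 1)

/-- `Y` is a stationary and ergodic binary process: its law on the space of doubly infinite
sequences is invariant and ergodic under the shift. -/
def IsStationaryErgodic {Ω : Type u} [MeasurableSpace Ω] (P : Measure Ω) (Y : ℤ → Ω → Bool) :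
    Prop :=
  (∀ i, Measurable (Y i)) ∧ Ergodic shift (P.map fun ω i => Y i ω)

/-- `U_1, U_2, …` are independent, uniformly distributed on `[0,1]` (`U 0` is never used). -/
def IsIIDUniform {Ω : Type u} [MeasurableSpace Ω] (P : Measure Ω) (U : ℕ → Ω → unitInterval) :
    Prop :=
  (∀ i, 1 ≤ i → Measurable (U i) ∧ P.map (U i) = volume) ∧ iIndepFun (fun i : ℕ => U (i + 1)) P

/-- The σ-algebra generated by the infinite past `…, Y_{-2}, Y_{-1}`. -/
abbrev pastSigma {Ω : Type u} (Y : ℤ → Ω → Bool) : MeasurableSpace Ω :=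
  ⨆ i : {i : ℤ // i < 0}, MeasurableSpace.comap (Y i) inferInstance

/-- The Bayes error
`L^* = E[min(P{Y_0 = 1 | Y_{-∞}^{-1}}, P{Y_0 = 0 | Y_{-∞}^{-1}})]`. -/
def bayesError {Ω : Type u} [MeasurableSpace Ω] (P : Measure Ω) (Y : ℤ → Ω → Bool) : ℝ :=
  ∫ ω, min ((P⟦Y 0 ⁻¹' {true} | pastSigma Y⟧) ω) ((P⟦Y 0 ⁻¹' {false} | pastSigma Y⟧) ω) ∂P

/-- A strategy is universal if for every stationary ergodic binary process `Y`, and uniform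
randomizing variables `U_1, U_2, …` that are i.i.d. and independent of `Y`, the loss
`L_1^n(g, U_1^n)` on `Y_1, Y_2, …` tends to `L^*` almost surely. -/
def IsUniversal (g : Strategy) : Prop :=
  ∀ (Ω : Type u) [MeasurableSpace Ω] (P : Measure Ω) [IsProbabilityMeasure P]
    (Y : ℤ → Ω → Bool) (U : ℕ → Ω → unitInterval),
    IsStationaryErgodic P Y → IsIIDUniform P U →
    IndepFun (fun ω (i : ℤ) => Y i ω) (fun ω (i : ℕ) => U (i + 1) ω) P →
    ∀ᵐ ω ∂P, Tendsto (fun n : ℕ => loss g (fun i => Y i ω) (fun i => U i ω) 1 n)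
      atTop (𝓝 (bayesError P Y))

end SeqPred

end

/-! Regret bound (ii). Guessing 1 with probability `mixture` makes the expected mistake in a round
equal to the weighted average of the experts' mistakes. Hoeffding's lemma controls the decay of the
total weight, and comparison with the weight of a single expert gives regret at most (ln N)/η +
η·length/8 on a dyadic block (`sum_weightedAverage_le`). Only N = 2^(m+1) experts vote there, but
experts of higher order agree with the last of them on that block, so every k is covered. The block
regrets form an essentially geometric sum with ratio √2.

Universality (i). For a fixed sequence, the loss and its expectation differ by an average of bounded
independent centred variables, which tends to 0; Fubini carries this over to random sequences. It
remains to show that the expected loss tends to the Bayes error. For any strategy, the mistake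
probability minus its conditional expectation given the infinite past is an orthogonal sequence, so
its averages vanish (`ae_tendsto_sum_martingaleDifference_div`). The conditional loss is never below
min(q, 1 - q), whose time average converges by Birkhoff: this is the lower bound. For the upper
bound, empirical frequencies converge to the conditional probabilities given k past bits, so the
k-th expert eventually makes the optimal k-bit decision. Its excess over the Bayes error is at most
twice the L¹ distance between the k-bit and infinite-past probabilities, which vanishes by Lévy's
upward theorem. By (ii) the predictor inherits this bound for every k. -/

namespace SeqPred

/-! ### Birkhoff's theorem for ergodic maps, via the maximal inequality. -/

section Birkhoff

variable {α : Type*} {T : α → α} {f : α → ℝ}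

/-- The maximum of the Birkhoff sums `0 = S_0 f, …, S_n f`, defined by the recursion
`M_{n+1} = max(0, f + M_n ∘ T)`. -/
def maxBirkhoffSum (T : α → α) (f : α → ℝ) : ℕ → α → ℝ
  | 0, _ => 0
  | n + 1, x => max 0 (f x + maxBirkhoffSum T f n (T x))

theorem maxBirkhoffSum_nonneg (n : ℕ) (x : α) : 0 ≤ maxBirkhoffSum T f n x := by
  cases n <;> simp [maxBirkhoffSum]

theorem maxBirkhoffSum_le_succ (n : ℕ) (x : α) :
    maxBirkhoffSum T f n x ≤ maxBirkhoffSum T f (n + 1) x := by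
  induction n generalizing x with
  | zero => simp [maxBirkhoffSum]
  | succ n ih =>
    have := ih (T x)
    rw [maxBirkhoffSum, maxBirkhoffSum]
    gcongr

theorem birkhoffSum_le_maxBirkhoffSum (n : ℕ) (x : α) :
    birkhoffSum T f n x ≤ maxBirkhoffSum T f n x := by
  induction n generalizing x with
  | zero => simp [maxBirkhoffSum]
  | succ n ih =>
    rw [birkhoffSum_succ', maxBirkhoffSum]
    exact (add_le_add_right (ih (T x)) (f x)).trans (le_max_right _ _)

variable [MeasurableSpace α] {μ : Measure α}

theorem measurable_maxBirkhoffSum (hT : Measurable T) (hf : Measurable f) (n : ℕ) :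
    Measurable (maxBirkhoffSum T f n) := by
  induction n with
  | zero => exact measurable_const
  | succ n ih => exact measurable_const.max (hf.add (ih.comp hT))

theorem integrable_maxBirkhoffSum (hT : MeasurePreserving T μ μ) (hf : Integrable f μ) (n : ℕ) :
    Integrable (maxBirkhoffSum T f n) μ := by
  induction n with
  | zero => exact integrable_zero α ℝ μ
  | succ n ih =>
    exact (integrable_zero α ℝ μ).sup (hf.add (hT.integrable_comp_of_integrable ih))

/-- The maximal ergodic inequality for finitely many Birkhoff sums. -/
theorem setIntegral_maxBirkhoffSum_pos_nonneg (hT : MeasurePreserving T μ μ) (hfm : Measurable f)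
    (hf : Integrable f μ) (n : ℕ) :
    0 ≤ ∫ x in {x | 0 < maxBirkhoffSum T f n x}, f x ∂μ := by
  have hm := measurable_maxBirkhoffSum hT.measurable hfm n
  have hi := integrable_maxBirkhoffSum hT hf n
  have hiT : Integrable (fun x => maxBirkhoffSum T f n (T x)) μ := hT.integrable_comp_of_integrable hi
  have hs : MeasurableSet {x | 0 < maxBirkhoffSum T f n x} := measurableSet_lt measurable_const hm
  rw [← integral_indicator hs]
  have h0 : ∫ x, (maxBirkhoffSum T f n x - maxBirkhoffSum T f n (T x)) ∂μ = 0 := by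
    rw [integral_sub hi hiT, sub_eq_zero]
    have := integral_map (μ := μ) hT.measurable.aemeasurable
      (f := maxBirkhoffSum T f n) hm.aestronglyMeasurable
    rw [hT.map_eq] at this
    exact this
  -- Where M_n > 0, the bound M_n ≤ max(0, f + M_n ∘ T) forces M_n - M_n ∘ T ≤ f; elsewhere M_n = 0
  -- and the difference is at most 0.
  refine h0.symm.trans_le (integral_mono (hi.sub hiT) (hf.indicator hs) fun x => ?_)
  by_cases hx : 0 < maxBirkhoffSum T f n x
  · rw [Set.indicator_of_mem (by exact hx)]
    have h1 := maxBirkhoffSum_le_succ (T := T) (f := f) n x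
    rw [maxBirkhoffSum] at h1
    rcases le_max_iff.1 h1 with h | h <;> linarith
  · rw [Set.indicator_of_notMem (by exact hx)]
    have := maxBirkhoffSum_nonneg (T := T) (f := f) n (T x)
    linarith

/-- For an ergodic transformation, the Birkhoff sums of a function with negative integral are
almost surely bounded above. -/
theorem ae_bddAbove_birkhoffSum [IsProbabilityMeasure μ] (hT : Ergodic T μ) (hfm : Measurable f)
    (hf : Integrable f μ) (hneg : ∫ x, f x ∂μ < 0) :
    ∀ᵐ x ∂μ, BddAbove (Set.range fun n => birkhoffSum T f n x) := by
  have hSm : ∀ n, Measurable (birkhoffSum T f n) := fun n =>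
    Finset.measurable_sum _ fun k _ => hfm.comp (hT.measurable.iterate k)
  set s : Set α := {x | BddAbove (Set.range fun n => birkhoffSum T f n x)} with hsdef
  have hs : MeasurableSet s := measurableSet_bddAbove_range hSm
  -- Since S_{n+1}(x) = f(x) + S_n(Tx), boundedness along the orbits of x and Tx is equivalent;
  -- ergodicity then gives a zero-one law.
  have hinv : T ⁻¹' s = s := by
    ext x
    simp only [hsdef, Set.mem_preimage, Set.mem_ofPred_eq, bddAbove_def, Set.forall_mem_range]
    constructor
    · rintro ⟨C, hC⟩
      refine ⟨max 0 (f x + C), fun n => ?_⟩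
      cases n with
      | zero => simp
      | succ n =>
        rw [birkhoffSum_succ']
        exact le_max_of_le_right (by linarith [hC n])
    · rintro ⟨C, hC⟩
      refine ⟨C - f x, fun n => ?_⟩
      have := hC (n + 1)
      rw [birkhoffSum_succ'] at this
      linarith
  rcases hT.toPreErgodic.ae_mem_or_ae_notMem hs hinv with h | h
  · exact h
  · exfalso
    -- If the sums are a.e. unbounded above, the sets {M_n > 0} increase to full measure, and the
    -- maximal inequality yields ∫ f ≥ 0 in the limit.
    have hmono : Monotone fun n => {x | 0 < maxBirkhoffSum T f n x} :=
      monotone_nat_of_le_succ fun n x hx => lt_of_lt_of_le hx (maxBirkhoffSum_le_succ n x)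
    have hlim := tendsto_setIntegral_of_monotone (μ := μ) (f := f)
      (fun n => measurableSet_lt measurable_const
        (measurable_maxBirkhoffSum hT.measurable hfm n)) hmono hf.integrableOn
    have hU : (⋃ n, {x | 0 < maxBirkhoffSum T f n x}) =ᵐ[μ] Set.univ := by
      rw [eventuallyEq_univ]
      filter_upwards [h] with x hx
      have : ¬ ∀ n, birkhoffSum T f n x ≤ 0 := fun hC => hx ⟨0, by
        rintro _ ⟨n, rfl⟩; exact hC n⟩
      push Not at this
      obtain ⟨n, hn⟩ := this
      exact Set.mem_iUnion.2 ⟨n, hn.trans_le (birkhoffSum_le_maxBirkhoffSum n x)⟩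
    rw [setIntegral_congr_set hU, setIntegral_univ] at hlim
    exact absurd (ge_of_tendsto' hlim fun n =>
      setIntegral_maxBirkhoffSum_pos_nonneg hT.toMeasurePreserving hfm hf n) (not_le.2 hneg)

/-- Subtracting ∫ f + ε/2 makes the mean -ε/2, so the centred sums stay below some C, and C ≤ nε/2
for large n. -/
theorem ae_eventually_birkhoffSum_le [IsProbabilityMeasure μ] (hT : Ergodic T μ)
    (hfm : Measurable f) (hf : Integrable f μ) {ε : ℝ} (hε : 0 < ε) :
    ∀ᵐ x ∂μ, ∀ᶠ n : ℕ in atTop, birkhoffSum T f n x ≤ n * (∫ y, f y ∂μ + ε) := by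
  have h := ae_bddAbove_birkhoffSum (f := fun x => f x - (∫ y, f y ∂μ + ε / 2)) hT
    (hfm.sub_const _) (hf.sub (integrable_const _)) (by
      rw [integral_sub hf (integrable_const _)]; simp; linarith)
  filter_upwards [h] with x hx
  obtain ⟨C, hC⟩ := hx
  have hlarge : ∀ᶠ n : ℕ in atTop, C / (ε / 2) ≤ n :=
    tendsto_natCast_atTop_atTop.eventually_ge_atTop _
  filter_upwards [hlarge] with n hn
  have h1 : birkhoffSum T (fun x => f x - (∫ y, f y ∂μ + ε / 2)) n x ≤ C := hC ⟨n, rfl⟩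
  rw [div_le_iff₀ (by positivity)] at hn
  simp only [birkhoffSum, Finset.sum_sub_distrib, Finset.sum_const, Finset.card_range,
    nsmul_eq_mul] at h1 ⊢
  linarith

/-- **Birkhoff's pointwise ergodic theorem** for ergodic transformations. -/
theorem ae_tendsto_birkhoffSum_div [IsProbabilityMeasure μ] (hT : Ergodic T μ)
    (hfm : Measurable f) (hf : Integrable f μ) :
    ∀ᵐ x ∂μ, Tendsto (fun n : ℕ => (∑ i ∈ Finset.range n, f (T^[i] x)) / n) atTop
      (𝓝 (∫ y, f y ∂μ)) := by
  have hε : ∀ N : ℕ, (0 : ℝ) < 1 / (N + 1) := fun N => by positivity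
  have h1 := ae_all_iff.2 fun N : ℕ => ae_eventually_birkhoffSum_le hT hfm hf (hε N)
  have h2 := ae_all_iff.2 fun N : ℕ => ae_eventually_birkhoffSum_le hT hfm.neg hf.neg (hε N)
  filter_upwards [h1, h2] with x hx1 hx2
  rw [Metric.tendsto_nhds]
  intro ε hεpos
  obtain ⟨N, hN⟩ := exists_nat_one_div_lt hεpos
  filter_upwards [hx1 N, hx2 N, eventually_gt_atTop 0] with n a b hn
  have hn' : (0 : ℝ) < n := by exact_mod_cast hn
  simp only [birkhoffSum, Pi.neg_apply, Finset.sum_neg_distrib, integral_neg] at a b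
  rw [Real.dist_eq, abs_lt]
  constructor
  · have : (∫ y, f y ∂μ) - 1 / (N + 1) ≤ (∑ i ∈ Finset.range n, f (T^[i] x)) / n := by
      rw [le_div_iff₀ hn']; linarith
    linarith
  · have : (∑ i ∈ Finset.range n, f (T^[i] x)) / n ≤ (∫ y, f y ∂μ) + 1 / (N + 1) := by
      rw [div_le_iff₀ hn']; linarith
    linarith

end Birkhoff

/-! ### A strong law for bounded orthogonal variables. -/

section Orthogonal

variable {Ω : Type*} [MeasurableSpace Ω] {P : Measure Ω}

theorem integral_sum_sq_le_of_orthogonal [IsProbabilityMeasure P] {X : ℕ → Ω → ℝ}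
    (hm : ∀ i, Measurable (X i)) (hb : ∀ i ω, |X i ω| ≤ 1)
    (ho : ∀ i j, i < j → ∫ ω, X i ω * X j ω ∂P = 0) (n : ℕ) :
    ∫ ω, (∑ i ∈ Finset.range n, X i ω) ^ 2 ∂P ≤ n := by
  have hint : ∀ i j, Integrable (fun ω => X i ω * X j ω) P := fun i j =>
    Integrable.of_bound ((hm i).mul (hm j)).aestronglyMeasurable 1 (ae_of_all _ fun ω => by
      rw [norm_mul]
      exact mul_le_one₀ (hb i ω) (norm_nonneg _) (hb j ω))
  have ho' : ∀ i j, i ≠ j → ∫ ω, X i ω * X j ω ∂P = 0 := fun i j hij => by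
    rcases hij.lt_or_gt with h | h
    · exact ho i j h
    · simpa only [mul_comm] using ho j i h
  simp_rw [sq, Finset.sum_mul_sum]
  rw [integral_finsetSum _ fun i _ => integrable_finsetSum _ fun j _ => hint i j]
  simp_rw [integral_finsetSum _ fun j _ => hint _ j]
  calc ∑ i ∈ Finset.range n, ∑ j ∈ Finset.range n, ∫ ω, X i ω * X j ω ∂P
      = ∑ i ∈ Finset.range n, ∫ ω, X i ω * X i ω ∂P := by
        refine Finset.sum_congr rfl fun i hi => ?_
        exact Finset.sum_eq_single i (fun j _ hj => ho' i j hj.symm) (fun h => absurd hi h)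
    _ ≤ ∑ i ∈ Finset.range n, (1 : ℝ) := by
        refine Finset.sum_le_sum fun i _ => ?_
        calc ∫ ω, X i ω * X i ω ∂P ≤ ∫ _, (1 : ℝ) ∂P :=
              integral_mono (hint i i) (integrable_const _) fun ω => by
                have := hb i ω
                rw [← abs_mul_abs_self]
                exact mul_le_one₀ this (abs_nonneg _) this
          _ = 1 := by simp
    _ = n := by simp

/-- A deterministic interpolation step: averages of a sequence bounded by `1` tend to zero as soon
as they do so along the squares. -/
theorem tendsto_sum_div_of_tendsto_sq {x : ℕ → ℝ} (hb : ∀ i, |x i| ≤ 1)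
    (h : Tendsto (fun m : ℕ => (∑ i ∈ Finset.range ((m + 1) ^ 2), x i) / ((m : ℝ) + 1) ^ 2) atTop (𝓝 0)) :
    Tendsto (fun n : ℕ => (∑ i ∈ Finset.range n, x i) / n) atTop (𝓝 0) := by
  have hs : Tendsto (fun n : ℕ => Nat.sqrt (n + 1) - 1) atTop atTop := by
    refine tendsto_atTop.2 fun b => ?_
    filter_upwards [eventually_ge_atTop ((b + 1) * (b + 1))] with n hn
    have : b + 1 ≤ Nat.sqrt (n + 1) := Nat.le_sqrt.2 (by omega)
    omega
  have h1 : Tendsto (fun m : ℕ => |(∑ i ∈ Finset.range ((m + 1) ^ 2), x i) / ((m : ℝ) + 1) ^ 2|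
      + 3 * (1 / ((m : ℝ) + 1))) atTop (𝓝 0) := by
    have := h.abs.add ((tendsto_one_div_add_atTop_nhds_zero_nat (𝕜 := ℝ)).const_mul 3)
    simpa using this
  have h2 := h1.comp hs
  rw [← tendsto_add_atTop_iff_nat 1]
  refine squeeze_zero_norm (fun n => ?_) h2
  simp only [Function.comp_apply]
  obtain ⟨m, hm⟩ : ∃ m, Nat.sqrt (n + 1) = m + 1 :=
    ⟨Nat.sqrt (n + 1) - 1, by have : 0 < Nat.sqrt (n + 1) := Nat.sqrt_pos.2 (by omega)
                              omega⟩
  rw [hm, Nat.add_sub_cancel]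
  have hle : (m + 1) ^ 2 ≤ n + 1 := by rw [← hm, sq]; exact Nat.sqrt_le _
  have hlt : n + 1 ≤ (m + 1) ^ 2 + 2 * (m + 1) := by
    have := Nat.sqrt_le_add (n + 1); rw [hm] at this; nlinarith
  -- Past the square (m+1)² at most 2(m+1) terms remain before the next one; after division by
  -- (m+1)² they are negligible.
  have hsplit : |∑ i ∈ Finset.range (n + 1), x i| ≤
      |∑ i ∈ Finset.range ((m + 1) ^ 2), x i| + 2 * ((m : ℝ) + 1) := by
    rw [← Finset.sum_range_add_sum_Ico _ hle]
    refine (abs_add_le _ _).trans (add_le_add_right ?_ _)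
    refine (Finset.abs_sum_le_sum_abs _ _).trans ((Finset.sum_le_sum fun i _ => hb i).trans ?_)
    simp only [Finset.sum_const, Nat.card_Ico, nsmul_eq_mul, mul_one]
    have : n + 1 - (m + 1) ^ 2 ≤ 2 * (m + 1) := by omega
    exact_mod_cast this
  have hle' : ((m : ℝ) + 1) ^ 2 ≤ ((n + 1 : ℕ) : ℝ) := by exact_mod_cast hle
  have hm0 : (0 : ℝ) < (m : ℝ) + 1 := by positivity
  rw [Real.norm_eq_abs, abs_div, abs_div, Nat.abs_cast, abs_of_pos (by positivity : (0 : ℝ) < ((m : ℝ) + 1) ^ 2)]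
  calc _ ≤ (|∑ i ∈ Finset.range ((m + 1) ^ 2), x i| + 2 * ((m : ℝ) + 1)) / ((m : ℝ) + 1) ^ 2 := by
        gcongr
    _ = |∑ i ∈ Finset.range ((m + 1) ^ 2), x i| / ((m : ℝ) + 1) ^ 2 + 2 * (1 / ((m : ℝ) + 1)) := by
        field_simp
    _ ≤ _ := by gcongr; norm_num

/-- The strong law of large numbers for uniformly bounded orthogonal random variables. -/
theorem ae_tendsto_sum_div_of_orthogonal [IsProbabilityMeasure P] {X : ℕ → Ω → ℝ}
    (hm : ∀ i, Measurable (X i)) (hb : ∀ i ω, |X i ω| ≤ 1)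
    (ho : ∀ i j, i < j → ∫ ω, X i ω * X j ω ∂P = 0) :
    ∀ᵐ ω ∂P, Tendsto (fun n : ℕ => (∑ i ∈ Finset.range n, X i ω) / n) atTop (𝓝 0) := by
  -- Along the squares the second moments of the averages are at most 1/(m+1)². They are summable,
  -- so the sum of the `Z m` is a.e. finite and its terms tend to 0.
  set Z : ℕ → Ω → ℝ := fun m ω =>
    ((∑ i ∈ Finset.range ((m + 1) ^ 2), X i ω) / ((m : ℝ) + 1) ^ 2) ^ 2 with hZ
  have hSm : ∀ n, Measurable fun ω => ∑ i ∈ Finset.range n, X i ω := fun n =>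
    Finset.measurable_sum _ fun i _ => hm i
  have hZm : ∀ m, Measurable (Z m) := fun m => ((hSm _).div_const _).pow_const 2
  have hZle : ∀ m, ∫ ω, Z m ω ∂P ≤ 1 / ((m : ℝ) + 1) ^ 2 := fun m => by
    have h := integral_sum_sq_le_of_orthogonal hm hb ho ((m + 1) ^ 2)
    simp only [hZ, div_pow]
    rw [integral_div]
    calc _ ≤ (((m + 1) ^ 2 : ℕ) : ℝ) / (((m : ℝ) + 1) ^ 2) ^ 2 := by gcongr
      _ = _ := by push_cast; field_simp
  have hZint : ∀ m, Integrable (Z m) P := fun m => by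
    refine Integrable.of_bound (hZm m).aestronglyMeasurable 1 (ae_of_all _ fun ω => ?_)
    rw [Real.norm_eq_abs, abs_of_nonneg (sq_nonneg _), sq_le_one_iff_abs_le_one, abs_div,
      abs_of_pos (by positivity : (0 : ℝ) < ((m : ℝ) + 1) ^ 2), div_le_one (by positivity)]
    refine (Finset.abs_sum_le_sum_abs _ _).trans ((Finset.sum_le_sum fun i _ => hb i ω).trans ?_)
    simp
  have hfin : ∑' m, ∫⁻ ω, ENNReal.ofReal (Z m ω) ∂P ≠ ⊤ := by
    have hsum : Summable fun m : ℕ => 1 / ((m : ℝ) + 1) ^ 2 := by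
      have := (summable_nat_add_iff 1).2 (Real.summable_one_div_nat_pow.2 (le_refl 2))
      simpa using this
    refine ne_top_of_le_ne_top hsum.tsum_ofReal_ne_top (ENNReal.tsum_le_tsum fun m => ?_)
    rw [← ofReal_integral_eq_lintegral_ofReal (hZint m) (ae_of_all _ fun ω => sq_nonneg _)]
    exact ENNReal.ofReal_le_ofReal (hZle m)
  rw [← lintegral_tsum fun m => (hZm m).ennreal_ofReal.aemeasurable] at hfin
  filter_upwards [ae_lt_top' (AEMeasurable.tsum fun m => (hZm m).ennreal_ofReal.aemeasurable)
    hfin] with ω hω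
  refine tendsto_sum_div_of_tendsto_sq (fun i => hb i ω) ?_
  have h0 := ENNReal.tendsto_atTop_zero_of_tsum_ne_top hω.ne
  have h1 := (ENNReal.tendsto_toReal ENNReal.zero_ne_top).comp h0
  have h2 : Tendsto (fun m => Z m ω) atTop (𝓝 0) := by
    refine h1.congr fun m => ?_
    simp [ENNReal.toReal_ofReal (sq_nonneg _), hZ]
  have h3 := h2.sqrt
  simp only [hZ, Real.sqrt_sq_eq_abs, Real.sqrt_zero] at h3
  exact (tendsto_zero_iff_abs_tendsto_zero _).2 h3

end Orthogonal

end SeqPred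

noncomputable section

namespace SeqPred

/-! ### Uniform thresholds and Hoeffding's lemma. -/

section Threshold

theorem volume_real_unitInterval_le {a : ℝ} (h0 : 0 ≤ a) (h1 : a ≤ 1) :
    (volume : Measure unitInterval).real {u | (u : ℝ) ≤ a} = a := by
  have : {u : unitInterval | (u : ℝ) ≤ a} = Set.Iic ⟨a, h0, h1⟩ := rfl
  rw [this, Measure.real, unitInterval.volume_Iic]
  simp [h0]

theorem measurableSet_unitInterval_le (a : ℝ) : MeasurableSet {u : unitInterval | (u : ℝ) ≤ a} :=
  measurableSet_le measurable_subtype_coe measurable_const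

theorem integral_indicator_unitInterval_le {a : ℝ} (h0 : 0 ≤ a) (h1 : a ≤ 1) :
    ∫ u : unitInterval, {u : unitInterval | (u : ℝ) ≤ a}.indicator (fun _ => (1 : ℝ)) u = a := by
  rw [integral_indicator_const _ (measurableSet_unitInterval_le a),
    volume_real_unitInterval_le h0 h1, smul_eq_mul, mul_one]

/-- Hoeffding's lemma for a Bernoulli random variable. -/
theorem bernoulli_mgf_le {p : ℝ} (h0 : 0 ≤ p) (h1 : p ≤ 1) (η : ℝ) :
    1 - p + p * Real.exp (-η) ≤ Real.exp (-η * p + η ^ 2 / 8) := by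
  -- A Bernoulli(p) variable realised on the unit interval, so that the sub-Gaussian bound for
  -- variables in [0,1] applies at -η.
  set X : unitInterval → ℝ := {u : unitInterval | (u : ℝ) ≤ p}.indicator (fun _ => (1 : ℝ)) with hX
  have hXm : Measurable X := measurable_const.indicator (measurableSet_unitInterval_le p)
  have hX01 : ∀ u, X u = 0 ∨ X u = 1 := fun u => by
    by_cases hu : u ∈ {u : unitInterval | (u : ℝ) ≤ p} <;> simp [hX, hu]
  have hXi : ∫ u, X u = p := integral_indicator_unitInterval_le h0 h1
  have hXint : Integrable X := Integrable.of_bound hXm.aestronglyMeasurable 1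
    (ae_of_all _ fun u => by rcases hX01 u with h | h <;> simp [h])
  have h := (hasSubgaussianMGF_of_mem_Icc (μ := (volume : Measure unitInterval)) (a := 0) (b := 1)
    hXm.aemeasurable (ae_of_all _ fun u => by rcases hX01 u with h | h <;> simp [h])).mgf_le (-η)
  have hmgf : mgf (fun u => X u - ∫ v, X v) volume (-η) =
      (1 - p + p * Real.exp (-η)) * Real.exp (η * p) := by
    have : ∀ u, Real.exp (-η * (X u - p)) =
        Real.exp (η * p) + X u * ((Real.exp (-η) - 1) * Real.exp (η * p)) := fun u => by
      rcases hX01 u with h | h <;> rw [h]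
      · simp
      · rw [show -η * (1 - p) = -η + η * p by ring, Real.exp_add]; ring
    rw [mgf, hXi]
    simp_rw [this]
    rw [integral_add (integrable_const _) (hXint.mul_const _), integral_mul_const, hXi]
    simp
    ring
  rw [hmgf] at h
  rw [Real.exp_add, show -η * p = -(η * p) by ring, Real.exp_neg (η * p), inv_mul_eq_div,
    le_div_iff₀ (Real.exp_pos _)]
  refine h.trans_eq (congrArg Real.exp ?_)
  simp
  ring

end Threshold

/-! ### Regret of exponentially weighted averages. -/

section ExponentialWeights

variable {κ : Type*} {K : Finset κ} {ℓ : ℕ → κ → ℝ}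

/-- The regret bound for the exponentially weighted average forecaster with `0`-`1` losses. -/
theorem sum_weightedAverage_le (hℓ : ∀ t k, ℓ t k = 0 ∨ ℓ t k = 1) {η : ℝ} (hη : 0 < η)
    {a n : ℕ} (han : a ≤ n) {k : κ} (hk : k ∈ K) :
    ∑ t ∈ Finset.Ico a n, (∑ j ∈ K, ℓ t j * Real.exp (-η * ∑ s ∈ Finset.Ico a t, ℓ s j)) /
        (∑ j ∈ K, Real.exp (-η * ∑ s ∈ Finset.Ico a t, ℓ s j)) ≤
      ∑ t ∈ Finset.Ico a n, ℓ t k + Real.log K.card / η + η * (n - a) / 8 := by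
  set w : ℕ → κ → ℝ := fun t j => Real.exp (-η * ∑ s ∈ Finset.Ico a t, ℓ s j) with hw
  have hwpos : ∀ t j, 0 < w t j := fun t j => Real.exp_pos _
  set W : ℕ → ℝ := fun t => ∑ j ∈ K, w t j with hW
  have hWpos : ∀ t, 0 < W t := fun t => Finset.sum_pos (fun j _ => hwpos t j) ⟨k, hk⟩
  set r : ℕ → ℝ := fun t => (∑ j ∈ K, ℓ t j * w t j) / W t with hr
  have hKpos : (0 : ℝ) < K.card := by exact_mod_cast Finset.card_pos.2 ⟨k, hk⟩
  -- The total weight serves as potential: as losses are 0 or 1, one round multiplies it by exactly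
  -- 1 - r + r·exp(-η), which `bernoulli_mgf_le` bounds.
  have hmain : ∀ n, a ≤ n →
      W n ≤ K.card * Real.exp (-η * ∑ t ∈ Finset.Ico a n, r t + η ^ 2 / 8 * (n - a)) := by
    intro n han
    induction n, han using Nat.le_induction with
    | base => simp [hW, hw]
    | succ n han ih =>
      have hr0 : 0 ≤ r n := div_nonneg (Finset.sum_nonneg fun j _ => mul_nonneg
        (by rcases hℓ n j with h | h <;> simp [h]) (hwpos n j).le) (hWpos n).le
      have hr1 : r n ≤ 1 := by
        rw [hr, div_le_one (hWpos n)]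
        refine Finset.sum_le_sum fun j _ => mul_le_of_le_one_left (hwpos n j).le ?_
        rcases hℓ n j with h | h <;> simp [h]
      have hstep : W (n + 1) = W n * (1 - r n + r n * Real.exp (-η)) := by
        have h1 : ∀ j, w (n + 1) j = w n j + (Real.exp (-η) - 1) * (ℓ n j * w n j) := fun j => by
          simp only [hw]
          rw [Finset.sum_Ico_succ_top han, mul_add, Real.exp_add]
          rcases hℓ n j with h | h <;> rw [h]
          · simp
          · rw [mul_one]; ring
        have h2 : ∑ j ∈ K, ℓ n j * w n j = r n * W n := (div_mul_cancel₀ _ (hWpos n).ne').symm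
        calc W (n + 1) = W n + (Real.exp (-η) - 1) * ∑ j ∈ K, ℓ n j * w n j := by
              rw [hW, Finset.mul_sum, ← Finset.sum_add_distrib]
              exact Finset.sum_congr rfl fun j _ => h1 j
          _ = _ := by rw [h2]; ring
      rw [hstep, Finset.sum_Ico_succ_top han]
      calc W n * (1 - r n + r n * Real.exp (-η))
          ≤ (K.card * Real.exp (-η * ∑ t ∈ Finset.Ico a n, r t + η ^ 2 / 8 * (n - a))) *
              Real.exp (-η * r n + η ^ 2 / 8) := by
            refine mul_le_mul ih (bernoulli_mgf_le hr0 hr1 η) ?_ (by positivity)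
            have := Real.exp_pos (-η)
            nlinarith
        _ = _ := by
            rw [mul_assoc, ← Real.exp_add]
            congr 2
            push_cast
            ring
  -- Keeping only expert k bounds the potential from below; taking logarithms and dividing by η
  -- gives the regret.
  have hlow : w n k ≤ W n := Finset.single_le_sum (fun j _ => (hwpos n j).le) hk
  have h := Real.log_le_log (hwpos n k) (hlow.trans (hmain n han))
  rw [Real.log_mul hKpos.ne' (Real.exp_pos _).ne', Real.log_exp, Real.log_exp] at h
  refine le_of_mul_le_mul_left ?_ hη
  have : η * (Real.log K.card / η) = Real.log K.card := by field_simp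
  rw [mul_add, mul_add, this]
  linarith

end ExponentialWeights

/-! ### Expected loss of the predictor and the regret bound (ii). -/

section Predictor

/-- The numerical value of a bit. -/
def bit (b : Bool) : ℝ := if b = true then 1 else 0

/-- The probability with which the predictor guesses `1`. -/
def mixture {n : ℕ} (y : Past n) : ℝ :=
  (∑ k ∈ Finset.Icc 1 (2 ^ (Nat.log 2 n + 1)), bit (expert k n y) * weight y k) /
    (∑ k ∈ Finset.Icc 1 (2 ^ (Nat.log 2 n + 1)), weight y k)

theorem bit_nonneg (b : Bool) : 0 ≤ bit b := by cases b <;> simp [bit]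

theorem bit_le_one (b : Bool) : bit b ≤ 1 := by cases b <;> simp [bit]

theorem weight_pos {n : ℕ} (y : Past n) (k : ℕ) : 0 < weight y k := Real.exp_pos _

theorem sum_weight_pos {n : ℕ} (y : Past n) (m : ℕ) :
    0 < ∑ k ∈ Finset.Icc 1 (2 ^ m), weight y k :=
  Finset.sum_pos (fun k _ => weight_pos y k) ⟨1, by simp [Nat.one_le_two_pow]⟩

theorem mixture_nonneg {n : ℕ} (y : Past n) : 0 ≤ mixture y :=
  div_nonneg (Finset.sum_nonneg fun k _ => mul_nonneg (bit_nonneg _) (weight_pos y k).le)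
    (sum_weight_pos y _).le

theorem mixture_le_one {n : ℕ} (y : Past n) : mixture y ≤ 1 := by
  rw [mixture, div_le_one (sum_weight_pos y _)]
  exact Finset.sum_le_sum fun k _ => mul_le_of_le_one_left (weight_pos y k).le (bit_le_one _)

theorem predictor_eq {n : ℕ} (y : Past n) (u : unitInterval) :
    predictor n y u = if (u : ℝ) ≤ mixture y then true else false := by
  have : predictor n y u = if (u : ℝ) > mixture y then false else true := rfl
  rw [this]
  by_cases h : (u : ℝ) ≤ mixture y <;> simp [h, not_lt, not_le.1]

/-- The indicator of a mistake. -/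
def mistake (b c : Bool) : ℝ := if b ≠ c then 1 else 0

theorem mistake_eq_abs (b c : Bool) : mistake b c = |bit b - bit c| := by
  cases b <;> cases c <;> simp [mistake, bit]

theorem mistake_predictor_eq {n : ℕ} (y : Past n) (b : Bool) (u : unitInterval) :
    mistake (predictor n y u) b = bit b +
      (1 - 2 * bit b) * {u : unitInterval | (u : ℝ) ≤ mixture y}.indicator (fun _ => (1 : ℝ)) u := by
  rw [predictor_eq]
  by_cases h : (u : ℝ) ≤ mixture y <;> cases b <;> simp [mistake, bit, h, -not_le]
  norm_num

theorem measurable_mistake_predictor {n : ℕ} (y : Past n) (b : Bool) :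
    Measurable fun u => mistake (predictor n y u) b := by
  simp_rw [mistake_predictor_eq]
  exact ((measurable_const.indicator (measurableSet_unitInterval_le _)).const_mul _).const_add _

theorem integral_mistake_predictor {n : ℕ} (y : Past n) (b : Bool) :
    ∫ u, mistake (predictor n y u) b = |mixture y - bit b| := by
  simp_rw [mistake_predictor_eq]
  rw [integral_add (integrable_const _), integral_const_mul,
    integral_indicator_unitInterval_le (mixture_nonneg y) (mixture_le_one y)]
  · have h0 := mixture_nonneg y
    have h1 := mixture_le_one y
    cases b
    · simp [bit, abs_of_nonneg h0]
    · rw [abs_of_nonpos (by simpa [bit] using h1)]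
      simp [bit]
      ring
  · exact ((integrable_const (1 : ℝ)).indicator (measurableSet_unitInterval_le _)).const_mul _

theorem avgMistakes_one (guess y : ℕ → Bool) (n : ℕ) :
    avgMistakes guess y 1 n = (∑ i ∈ Finset.Icc 1 n, mistake (guess i) (y i)) / n := by
  simp [avgMistakes, mistake]

theorem abs_mistake_le_one (b c : Bool) : |mistake b c| ≤ 1 := by
  cases b <;> cases c <;> simp [mistake]

theorem integral_mistake_predictor_infinitePi {n : ℕ} (y : Past n) (b : Bool) (i : ℕ) :
    ∫ u, mistake (predictor n y (u i)) b
      ∂(Measure.infinitePi fun _ : ℕ => (volume : Measure unitInterval)) =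
      |mixture y - bit b| := by
  rw [← integral_mistake_predictor]
  conv_rhs => rw [← Measure.infinitePi_map_eval (fun _ : ℕ => (volume : Measure unitInterval)) i]
  rw [integral_map (measurable_pi_apply i).aemeasurable
    (measurable_mistake_predictor y b).aestronglyMeasurable]

theorem expectedLoss_predictor (y : ℕ → Bool) (n : ℕ) :
    expectedLoss predictor y 1 n =
      (∑ i ∈ Finset.Icc 1 n, |mixture (past y i) - bit (y i)|) / n := by
  simp_rw [expectedLoss, loss, avgMistakes_one]
  rw [integral_div, integral_finsetSum]
  · simp_rw [integral_mistake_predictor_infinitePi]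
  · intro i _
    exact Integrable.of_bound ((measurable_mistake_predictor _ _).comp
      (measurable_pi_apply i)).aestronglyMeasurable 1 (ae_of_all _ fun u => abs_mistake_le_one _ _)

/-- On [0,1] the map c ↦ |c - b| is affine for a bit b, so it passes through the weighted average.
This puts the expected mistake in the form required by `sum_weightedAverage_le`. -/
theorem abs_mixture_sub_bit {n : ℕ} (y : Past n) (b : Bool) :
    |mixture y - bit b| =
      (∑ k ∈ Finset.Icc 1 (2 ^ (Nat.log 2 n + 1)), mistake (expert k n y) b * weight y k) /
        (∑ k ∈ Finset.Icc 1 (2 ^ (Nat.log 2 n + 1)), weight y k) := by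
  have hW := sum_weight_pos y (Nat.log 2 n + 1)
  cases b
  · rw [abs_of_nonneg (by simpa [bit] using mixture_nonneg y), mixture]
    have : ∀ c, mistake c false = bit c := fun c => by cases c <;> simp [mistake, bit]
    simp [this, bit]
  · rw [abs_of_nonpos (by simpa [bit] using mixture_le_one y), mixture]
    have : ∀ c, mistake c true = 1 - bit c := fun c => by cases c <;> simp [mistake, bit]
    simp_rw [this, sub_mul, Finset.sum_sub_distrib, one_mul, sub_div, div_self hW.ne']
    simp [bit]

theorem mistakesFrom_past (h : DetStrategy) (y : ℕ → Bool) {a : ℕ} (ha : 1 ≤ a) (n : ℕ) :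
    (mistakesFrom h a (past y n) : ℝ) =
      ∑ j ∈ Finset.Ico a n, mistake (h j (past y j)) (y j) := by
  simp only [mistake]
  rw [Finset.sum_boole, mistakesFrom]
  congr 1
  refine Finset.card_bij (fun i _ => (i : ℕ)) ?_ (fun i _ j _ hij => Subtype.ext hij) ?_
  · intro i hi
    rw [Finset.mem_filter] at hi ⊢
    exact ⟨Finset.mem_Ico.2 ⟨hi.2.1, i.2.2⟩, hi.2.2⟩
  · intro j hj
    rw [Finset.mem_filter, Finset.mem_Ico] at hj
    exact ⟨⟨j, ha.trans hj.1.1, hj.1.2⟩, by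
      rw [Finset.mem_filter]; exact ⟨Finset.mem_univ _, hj.1.1, hj.2⟩, rfl⟩

/-- Here the frequency takes its default value 1/2, which does not exceed 1/2. Hence all experts of
large order coincide in early rounds. -/
theorem expert_eq_true_of_le {k n : ℕ} (y : Past n) (h : n ≤ k + 1) : expert k n y = true := by
  rw [expert]
  split_ifs with h1 h2
  · rw [freq, if_neg (by omega)] at h2
    exact absurd h2 (lt_irrefl _)
  · rfl
  · rfl

theorem log_two_pow_succ (m : ℕ) : Real.log (2 ^ (m + 1)) = (m + 1) * Real.log 2 := by
  rw [Real.log_pow]; push_cast; ring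

theorem eta_pos (m : ℕ) : 0 < eta m := by
  have := Real.log_pos one_lt_two
  rw [eta, log_two_pow_succ]
  positivity

/-- The regret of the predictor within the block of rounds `2^m ≤ i < 2^{m+1}`. -/
theorem sum_Ico_abs_mixture_sub_bit_le (y : ℕ → Bool) {m n k : ℕ} (hm : 2 ^ m ≤ n)
    (hn : n ≤ 2 ^ (m + 1)) (hk : 1 ≤ k) :
    ∑ i ∈ Finset.Ico (2 ^ m) n, |mixture (past y i) - bit (y i)| ≤
      ∑ i ∈ Finset.Ico (2 ^ m) n, mistake (expert k i (past y i)) (y i) + eta m * 2 ^ m / 4 := by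
  -- All rounds of the block lie below 2^(m+1), so an expert of higher order may be replaced by the
  -- one of order 2^(m+1), which does vote.
  have hred : ∑ i ∈ Finset.Ico (2 ^ m) n, mistake (expert k i (past y i)) (y i) =
      ∑ i ∈ Finset.Ico (2 ^ m) n, mistake (expert (min k (2 ^ (m + 1))) i (past y i)) (y i) := by
    rcases le_total k (2 ^ (m + 1)) with h | h
    · rw [min_eq_left h]
    · rw [min_eq_right h]
      refine Finset.sum_congr rfl fun i hi => ?_
      rw [Finset.mem_Ico] at hi
      rw [expert_eq_true_of_le _ (by omega), expert_eq_true_of_le _ (by omega)]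
  have hreg := sum_weightedAverage_le (K := Finset.Icc 1 (2 ^ (m + 1)))
    (ℓ := fun i j => mistake (expert j i (past y i)) (y i))
    (fun t j => by simp only [mistake]; split_ifs <;> simp) (eta_pos m) hm
    (k := min k (2 ^ (m + 1)))
    (Finset.mem_Icc.2 ⟨le_min hk Nat.one_le_two_pow, min_le_right _ _⟩)
  rw [hred]
  have hL : ∑ i ∈ Finset.Ico (2 ^ m) n, |mixture (past y i) - bit (y i)| =
      ∑ t ∈ Finset.Ico (2 ^ m) n, (∑ j ∈ Finset.Icc 1 (2 ^ (m + 1)),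
        mistake (expert j t (past y t)) (y t) * Real.exp (-eta m * ∑ s ∈ Finset.Ico (2 ^ m) t,
          mistake (expert j s (past y s)) (y s))) /
        (∑ j ∈ Finset.Icc 1 (2 ^ (m + 1)), Real.exp (-eta m * ∑ s ∈ Finset.Ico (2 ^ m) t,
          mistake (expert j s (past y s)) (y s))) := by
    refine Finset.sum_congr rfl fun i hi => ?_
    rw [Finset.mem_Ico] at hi
    have hlog : Nat.log 2 i = m := Nat.log_eq_of_pow_le_of_lt_pow hi.1 (hi.2.trans_le hn)
    rw [abs_mixture_sub_bit]
    simp only [weight]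
    rw [hlog]
    simp_rw [mistakesFrom_past _ _ Nat.one_le_two_pow]
  rw [hL]
  refine hreg.trans ?_
  rw [add_assoc]
  refine add_le_add_right ?_ _
  have hη := eta_pos m
  have hsq : eta m ^ 2 = 8 * Real.log (2 ^ (m + 1)) / 2 ^ m := by
    rw [eta, Real.sq_sqrt]
    have := Real.log_pos one_lt_two
    rw [log_two_pow_succ]
    positivity
  -- The tuning of η: with 2^(m+1) experts, (ln N)/η equals η·2^m/8, the value of the quadratic term
  -- on a full block.
  have h1 : Real.log ((Finset.Icc 1 (2 ^ (m + 1))).card : ℝ) / eta m = eta m * 2 ^ m / 8 := by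
    rw [Nat.card_Icc, Nat.add_sub_cancel]
    push_cast
    rw [div_eq_iff hη.ne']
    have : eta m * 2 ^ m / 8 * eta m = eta m ^ 2 * 2 ^ m / 8 := by ring
    rw [this, hsq]
    field_simp
  have h2 : (n : ℝ) ≤ 2 * 2 ^ m := by rw [← pow_succ']; exact_mod_cast hn
  have h3 : eta m * (n - (2 ^ m : ℕ)) / 8 ≤ eta m * 2 ^ m / 8 := by
    push_cast
    gcongr
    linarith
  rw [h1]
  linarith

/-- The weights restart at each power of 2, so the regrets against the same expert add up over
blocks. -/
theorem sum_Ico_one_abs_mixture_sub_bit_le (y : ℕ → Bool) {k : ℕ} (hk : 1 ≤ k) (m : ℕ) :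
    ∑ i ∈ Finset.Ico 1 (2 ^ m), |mixture (past y i) - bit (y i)| ≤
      ∑ i ∈ Finset.Ico 1 (2 ^ m), mistake (expert k i (past y i)) (y i) +
        ∑ j ∈ Finset.range m, eta j * 2 ^ j / 4 := by
  induction m with
  | zero => simp
  | succ m ih =>
    have hle : 2 ^ m ≤ 2 ^ (m + 1) := Nat.pow_le_pow_right two_pos (Nat.le_succ m)
    rw [← Finset.sum_Ico_consecutive _ Nat.one_le_two_pow hle,
      ← Finset.sum_Ico_consecutive _ Nat.one_le_two_pow hle, Finset.sum_range_succ]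
    have := sum_Ico_abs_mixture_sub_bit_le y hle le_rfl hk
    linarith

/-- The j-th term is √(ln 2)·√(j+1)·√2^j/√2. Replacing j by M under the root leaves a geometric sum
of ratio √2, the origin of 1/(√2 - 1). -/
theorem sum_eta_le (M : ℕ) :
    ∑ j ∈ Finset.range (M + 1), eta j * 2 ^ j / 4 ≤
      Real.sqrt (Real.log 2) / (Real.sqrt 2 - 1) * Real.sqrt ((M + 1) * 2 ^ M) := by
  have hl := Real.log_pos one_lt_two
  have hr1 : 1 < Real.sqrt 2 := Real.lt_sqrt_of_sq_lt (by norm_num)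
  have hr0 : 0 < Real.sqrt 2 := by positivity
  have hpow : ∀ j : ℕ, Real.sqrt (2 ^ j) = Real.sqrt 2 ^ j := fun j =>
    (Real.sqrt_eq_iff_mul_self_eq (by positivity) (by positivity)).2 (by
      rw [← mul_pow, Real.mul_self_sqrt zero_le_two])
  have hterm : ∀ j ∈ Finset.range (M + 1), eta j * 2 ^ j / 4 ≤
      Real.sqrt (Real.log 2) * Real.sqrt (M + 1) / Real.sqrt 2 * Real.sqrt 2 ^ j := by
    intro j hj
    have hjM : (j : ℝ) ≤ M := by exact_mod_cast Nat.lt_succ_iff.1 (Finset.mem_range.1 hj)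
    have h1 : eta j * 2 ^ j / 4 =
        Real.sqrt (Real.log 2) * Real.sqrt (j + 1) / Real.sqrt 2 * Real.sqrt 2 ^ j := by
      rw [← hpow, eta, log_two_pow_succ, ← Real.sqrt_mul hl.le, ← Real.sqrt_div (by positivity),
        ← Real.sqrt_mul (by positivity)]
      have h2 : (2 : ℝ) ^ j / 4 = Real.sqrt ((2 ^ j / 4) ^ 2) := (Real.sqrt_sq (by positivity)).symm
      rw [mul_div_assoc, h2, ← Real.sqrt_mul (by positivity)]
      congr 1
      field_simp
      norm_num
    rw [h1]
    gcongr
  refine (Finset.sum_le_sum hterm).trans ?_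
  rw [← Finset.mul_sum, geom_sum_eq hr1.ne', Real.sqrt_mul (by positivity), hpow]
  have hd : 0 < Real.sqrt 2 - 1 := by linarith
  calc Real.sqrt (Real.log 2) * Real.sqrt (M + 1) / Real.sqrt 2 *
        ((Real.sqrt 2 ^ (M + 1) - 1) / (Real.sqrt 2 - 1))
      ≤ Real.sqrt (Real.log 2) * Real.sqrt (M + 1) / Real.sqrt 2 *
        (Real.sqrt 2 ^ (M + 1) / (Real.sqrt 2 - 1)) := by
        gcongr
        linarith
    _ = _ := by
        rw [pow_succ]
        field_simp

theorem expectedLoss_predictor_le (y : ℕ → Bool) {n : ℕ} (hn : 1 ≤ n) {k : ℕ} (hk : 1 ≤ k) :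
    expectedLoss predictor y 1 n ≤ detLoss (expert k) y 1 n +
      Real.sqrt (Real.log 2) / (Real.sqrt 2 - 1) *
        Real.sqrt ((Real.logb 2 (n : ℝ) + 1) / (n : ℝ)) := by
  set M := Nat.log 2 n with hM
  have hMn : 2 ^ M ≤ n := Nat.pow_log_le_self 2 (by omega)
  have hnM : n + 1 ≤ 2 ^ (M + 1) := Nat.lt_pow_succ_log_self one_lt_two n
  have hn0 : (0 : ℝ) < n := by exact_mod_cast hn
  have hr1 : 1 < Real.sqrt 2 := Real.lt_sqrt_of_sq_lt (by norm_num)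
  have hd : 0 < Real.sqrt 2 - 1 := by linarith
  -- The last block may be incomplete but is charged its full regret.
  have hsum : ∑ i ∈ Finset.Icc 1 n, |mixture (past y i) - bit (y i)| ≤
      ∑ i ∈ Finset.Icc 1 n, mistake (expert k i (past y i)) (y i) +
        ∑ j ∈ Finset.range (M + 1), eta j * 2 ^ j / 4 := by
    have hIcc : Finset.Icc 1 n = Finset.Ico 1 (n + 1) := by ext; simp
    rw [hIcc, ← Finset.sum_Ico_consecutive _ Nat.one_le_two_pow (hMn.trans n.le_succ),
      ← Finset.sum_Ico_consecutive _ Nat.one_le_two_pow (hMn.trans n.le_succ),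
      Finset.sum_range_succ]
    have h1 := sum_Ico_one_abs_mixture_sub_bit_le y hk M
    have h2 := sum_Ico_abs_mixture_sub_bit_le y (hMn.trans n.le_succ) hnM hk
    linarith
  have hlogb : (M : ℝ) ≤ Real.logb 2 n := by
    rw [Real.le_logb_iff_rpow_le one_lt_two hn0, Real.rpow_natCast]
    exact_mod_cast hMn
  rw [expectedLoss_predictor, detLoss, avgMistakes_one]
  have hsq : Real.sqrt ((Real.logb 2 (n : ℝ) + 1) / (n : ℝ)) =
      Real.sqrt ((Real.logb 2 n + 1) * n) / n := by
    have : (Real.logb 2 (n : ℝ) + 1) / (n : ℝ) = (Real.logb 2 n + 1) * n / n ^ 2 := by field_simp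
    rw [this, Real.sqrt_div' _ (by positivity), Real.sqrt_sq hn0.le]
  rw [hsq, ← mul_div_assoc, ← add_div]
  gcongr
  refine hsum.trans (add_le_add_right ((sum_eta_le M).trans ?_) _)
  have : (2 : ℝ) ^ M ≤ n := by exact_mod_cast hMn
  have : 0 ≤ Real.logb 2 n + 1 := by linarith [M.cast_nonneg (α := ℝ)]
  gcongr

end Predictor

end SeqPred

end

noncomputable section

namespace SeqPred

/-! ### Losses on path space and conditional expectation given the infinite past. -/

section PathSpace

/-- The σ-algebra generated by the coordinates with negative index. -/
abbrev pathPast : MeasurableSpace (ℤ → Bool) := pastSigma fun (i : ℤ) (x : ℤ → Bool) => x i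

/-- The one-sided sequence formed by the coordinates with nonnegative index. -/
def forward (x : ℤ → Bool) : ℕ → Bool := fun i => x i

/-- Translation of a doubly infinite sequence by `n` places. -/
def translate (n : ℤ) (x : ℤ → Bool) : ℤ → Bool := fun i => x (i + n)

/-- The block `(x_{-k}, …, x_{-1})`. -/
def lastBlock (k : ℕ) (x : ℤ → Bool) : Fin k → Bool := fun j => x (-k + j)

theorem pathPast_le : pathPast ≤ MeasurableSpace.pi :=
  iSup_le fun i => (measurable_pi_apply (i : ℤ)).comap_le

theorem measurable_pathPast_eval {i : ℤ} (hi : i < 0) :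
    Measurable[pathPast] fun x : ℤ → Bool => x i :=
  measurable_iff_comap_le.2 (le_iSup (fun i : {i : ℤ // i < 0} =>
    MeasurableSpace.comap (fun x : ℤ → Bool => x i) inferInstance) ⟨i, hi⟩)

theorem measurable_pathPast_translate {l : ℤ} (hl : l ≤ 0) :
    Measurable[pathPast, pathPast] (translate l) := by
  rw [measurable_iff_comap_le, MeasurableSpace.comap_iSup]
  refine iSup_le fun i => ?_
  rw [MeasurableSpace.comap_comp]
  exact measurable_iff_comap_le.1 (measurable_pathPast_eval (i := i + l) (by have := i.2; omega))

theorem shift_iterate (n : ℕ) : shift^[n] = translate n := by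
  induction n with
  | zero => ext x i; simp [translate]
  | succ n ih =>
    rw [Function.iterate_succ', ih]
    ext x i
    simp only [Function.comp_apply, shift, translate]
    congr 1
    push_cast
    ring

theorem translate_neg_translate (n : ℤ) (x : ℤ → Bool) : translate (-n) (translate n x) = x := by
  ext i; simp [translate]

theorem measurable_translate (n : ℤ) : Measurable (translate n) :=
  measurable_pi_lambda _ fun i => measurable_pi_apply (i + n)

theorem measurable_bit : Measurable bit := measurable_of_finite _

theorem measurable_lastBlock (k : ℕ) : Measurable (lastBlock k) :=
  measurable_pi_lambda _ fun _ => measurable_pi_apply _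

theorem measurable_past_forward (n : ℕ) : Measurable fun x : ℤ → Bool => past (forward x) n :=
  measurable_pi_lambda _ fun _ => measurable_pi_apply _

theorem sum_Icc_one_eq_sum_range {M : Type*} [AddCommMonoid M] (f : ℕ → M) (n : ℕ) :
    ∑ i ∈ Finset.Icc 1 n, f i = ∑ i ∈ Finset.range n, f (i + 1) := by
  induction n with
  | zero => simp
  | succ n ih => rw [Finset.sum_Icc_succ_top (by omega), ih, Finset.sum_range_succ]

theorem tendsto_sum_Icc_div_of_eventually_eq_zero {u : ℕ → ℝ} (h : ∀ᶠ i in atTop, u i = 0) :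
    Tendsto (fun n : ℕ => (∑ i ∈ Finset.Icc 1 n, u i) / n) atTop (𝓝 0) := by
  have h1 : Tendsto (fun i => u (i + 1)) atTop (𝓝 0) :=
    (tendsto_add_atTop_iff_nat 1).2 (tendsto_const_nhds.congr' (h.mono fun i hi => hi.symm))
  refine h1.cesaro.congr fun n => ?_
  rw [sum_Icc_one_eq_sum_range, div_eq_inv_mul]

theorem tendsto_sum_Icc_div_congr {u v : ℕ → ℝ} {l : ℝ} (h : ∀ᶠ i in atTop, u i = v i)
    (hv : Tendsto (fun n : ℕ => (∑ i ∈ Finset.Icc 1 n, v i) / n) atTop (𝓝 l)) :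
    Tendsto (fun n : ℕ => (∑ i ∈ Finset.Icc 1 n, u i) / n) atTop (𝓝 l) := by
  have := (tendsto_sum_Icc_div_of_eventually_eq_zero (u := fun i => u i - v i)
    (h.mono fun i hi => sub_eq_zero.2 hi)).add hv
  rw [zero_add] at this
  refine this.congr fun n => ?_
  rw [Finset.sum_sub_distrib]
  ring

variable {μ : Measure (ℤ → Bool)}

theorem measurePreserving_translate (h : MeasurePreserving shift μ μ) (n : ℕ) :
    MeasurePreserving (translate n) μ μ := shift_iterate n ▸ h.iterate n

theorem integral_comp_translate (h : MeasurePreserving shift μ μ) (n : ℕ) {f : (ℤ → Bool) → ℝ}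
    (hf : Measurable f) : ∫ x, f (translate n x) ∂μ = ∫ x, f x ∂μ := by
  have h' := measurePreserving_translate h n
  have := integral_map (μ := μ) h'.measurable.aemeasurable (f := f) hf.aestronglyMeasurable
  rw [h'.map_eq] at this
  exact this.symm

theorem ae_tendsto_sum_translate_div [IsProbabilityMeasure μ] (h : Ergodic shift μ)
    {f : (ℤ → Bool) → ℝ} (hf : Measurable f) (hi : Integrable f μ) :
    ∀ᵐ x ∂μ, Tendsto (fun n : ℕ => (∑ i ∈ Finset.Icc 1 n, f (translate i x)) / n) atTop
      (𝓝 (∫ x, f x ∂μ)) := by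
  have h1 := measurePreserving_translate h.toMeasurePreserving 1
  -- Birkhoff averages start at time 0; composing f with one shift moves them to the times 1, …, n.
  have := ae_tendsto_birkhoffSum_div h (hf.comp h1.measurable) (h1.integrable_comp_of_integrable hi)
  filter_upwards [this] with x hx
  simp only [Function.comp_apply, integral_comp_translate h.toMeasurePreserving 1 hf] at hx
  refine hx.congr fun n => ?_
  rw [sum_Icc_one_eq_sum_range]
  congr 1
  refine Finset.sum_congr rfl fun i _ => ?_
  rw [shift_iterate]
  congr 1
  ext j
  simp only [translate]
  congr 1
  push_cast
  ring

/-- A version of `P(x_0 = 1 | x_{-∞}^{-1})` with values in `[0,1]`. -/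
def condProbOne (μ : Measure (ℤ → Bool)) (x : ℤ → Bool) : ℝ :=
  max 0 (min 1 ((μ[fun x => bit (x 0) | pathPast]) x))

theorem condProbOne_nonneg (x : ℤ → Bool) : 0 ≤ condProbOne μ x := le_max_left _ _

theorem condProbOne_le_one (x : ℤ → Bool) : condProbOne μ x ≤ 1 :=
  max_le zero_le_one (min_le_left _ _)

theorem measurable_pathPast_condProbOne : Measurable[pathPast] (condProbOne μ) :=
  measurable_const.max (measurable_const.min stronglyMeasurable_condExp.measurable)

theorem measurable_condProbOne : Measurable (condProbOne μ) :=
  measurable_pathPast_condProbOne.mono pathPast_le le_rfl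

theorem measurable_bit_eval (i : ℤ) : Measurable fun x : ℤ → Bool => bit (x i) :=
  measurable_bit.comp (measurable_pi_apply i)

theorem integrable_of_mem_Icc [IsProbabilityMeasure μ] {f : (ℤ → Bool) → ℝ} (hf : Measurable f)
    (h0 : ∀ x, 0 ≤ f x) (h1 : ∀ x, f x ≤ 1) : Integrable f μ :=
  Integrable.of_bound hf.aestronglyMeasurable 1 (ae_of_all _ fun x => by
    rw [Real.norm_eq_abs, abs_of_nonneg (h0 x)]; exact h1 x)

theorem integrable_bit_eval [IsProbabilityMeasure μ] (i : ℤ) :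
    Integrable (fun x : ℤ → Bool => bit (x i)) μ :=
  integrable_of_mem_Icc (measurable_bit_eval i) (fun _ => bit_nonneg _) fun _ => bit_le_one _

theorem integrable_condProbOne [IsProbabilityMeasure μ] : Integrable (condProbOne μ) μ :=
  integrable_of_mem_Icc measurable_condProbOne condProbOne_nonneg condProbOne_le_one

theorem condProbOne_ae_eq [IsProbabilityMeasure μ] :
    condProbOne μ =ᵐ[μ] μ[fun x => bit (x 0) | pathPast] := by
  have h0 : 0 ≤ᵐ[μ] μ[fun x => bit (x 0) | pathPast] :=
    condExp_nonneg (ae_of_all _ fun x => bit_nonneg _)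
  have h1 := condExp_mono (m := pathPast) (integrable_bit_eval (μ := μ) 0)
    (integrable_const (1 : ℝ)) (ae_of_all _ fun x => bit_le_one (x 0))
  rw [condExp_const pathPast_le] at h1
  filter_upwards [h0, h1] with x hx0 hx1
  rw [condProbOne, min_eq_right hx1]
  exact max_eq_right hx0

/-- The pull-out property: the innovation at time 0 is orthogonal to every bounded function of the
past. -/
theorem integral_mul_bit_sub_condProbOne [IsProbabilityMeasure μ] {Z : (ℤ → Bool) → ℝ}
    (hZ : Measurable[pathPast] Z) (hb : ∀ x, |Z x| ≤ 1) :
    ∫ x, Z x * (bit (x 0) - condProbOne μ x) ∂μ = 0 := by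
  have hint : ∀ {f : (ℤ → Bool) → ℝ}, Measurable f → (∀ x, 0 ≤ f x) → (∀ x, f x ≤ 1) →
      Integrable (fun x => Z x * f x) μ := fun {f} hf h0 h1 =>
    Integrable.of_bound ((hZ.mono pathPast_le le_rfl).mul hf).aestronglyMeasurable 1
      (ae_of_all _ fun x => by
        rw [norm_mul]
        exact mul_le_one₀ (hb x) (norm_nonneg _) (by
          rw [Real.norm_eq_abs, abs_of_nonneg (h0 x)]; exact h1 x))
  have h := condExp_stronglyMeasurable_mul_of_bound pathPast_le hZ.stronglyMeasurable
    (integrable_bit_eval (μ := μ) 0) 1 (ae_of_all _ hb)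
  have h1 : ∫ x, Z x * bit (x 0) ∂μ = ∫ x, Z x * condProbOne μ x ∂μ := by
    calc ∫ x, Z x * bit (x 0) ∂μ
        = ∫ x, (μ[Z * fun x => bit (x 0) | pathPast]) x ∂μ := (integral_condExp pathPast_le).symm
      _ = _ := by
        refine integral_congr_ae ?_
        filter_upwards [h, condProbOne_ae_eq (μ := μ)] with x hx hx'
        rw [hx, Pi.mul_apply, hx']
  simp_rw [mul_sub]
  rw [integral_sub (hint (measurable_bit_eval 0) (fun _ => bit_nonneg _) fun _ => bit_le_one _)
    (hint measurable_condProbOne condProbOne_nonneg condProbOne_le_one), h1, sub_self]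

theorem abs_one_sub_two_mul_le {c : ℝ} (h0 : 0 ≤ c) (h1 : c ≤ 1) : |1 - 2 * c| ≤ 1 := by
  rw [abs_le]; constructor <;> linarith

theorem abs_bit_sub_condProbOne_le (b : Bool) (x : ℤ → Bool) : |bit b - condProbOne μ x| ≤ 1 := by
  have := bit_nonneg b
  have := bit_le_one b
  have := condProbOne_nonneg (μ := μ) x
  have := condProbOne_le_one (μ := μ) x
  rw [abs_le]; constructor <;> linarith

/-- The fluctuations of the loss of a strategy around its conditional expectation given the
infinite past average out. -/
theorem ae_tendsto_sum_martingaleDifference_div [IsProbabilityMeasure μ]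
    (h : MeasurePreserving shift μ μ) {C : ∀ n, Past n → ℝ} (h0 : ∀ n y, 0 ≤ C n y)
    (h1 : ∀ n y, C n y ≤ 1) :
    ∀ᵐ x ∂μ, Tendsto (fun n : ℕ => (∑ i ∈ Finset.Icc 1 n, (1 - 2 * C i (past (forward x) i)) *
      (bit (x i) - condProbOne μ (translate i x))) / n) atTop (𝓝 0) := by
  set d : ℕ → (ℤ → Bool) → ℝ := fun i x => (1 - 2 * C i (past (forward x) i)) *
      (bit (x i) - condProbOne μ (translate i x)) with hd
  have hCm : ∀ i, Measurable fun y : Past i => 1 - 2 * C i y := fun i => measurable_of_finite _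
  have hdm : ∀ i, Measurable (d i) := fun i =>
    ((hCm i).comp (measurable_past_forward i)).mul
      ((measurable_bit_eval i).sub (measurable_condProbOne.comp (measurable_translate i)))
  have hC1 : ∀ i (y : Past i), |1 - 2 * C i y| ≤ 1 := fun i y =>
    abs_one_sub_two_mul_le (h0 i y) (h1 i y)
  have hd1 : ∀ i x, |d i x| ≤ 1 := fun i x => by
    rw [hd, abs_mul]
    exact mul_le_one₀ (hC1 _ _) (abs_nonneg _) (abs_bit_sub_condProbOne_le _ _)
  have horth : ∀ i j : ℕ, i < j → ∫ x, d i x * d j x ∂μ = 0 := by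
    intro i j hij
    -- By stationarity time j is moved to the origin. Apart from the innovation at time j, every
    -- factor of the product then depends only on negative coordinates, because i < j.
    set Z : (ℤ → Bool) → ℝ := fun x => (1 - 2 * C i (past (forward (translate (-j) x)) i)) *
      (bit (x (i - j)) - condProbOne μ (translate (i - j) x)) *
      (1 - 2 * C j (past (forward (translate (-j) x)) j)) with hZ
    have hpast : ∀ l ≤ j, Measurable[pathPast] fun x => past (forward (translate (-j) x)) l := by
      intro l hl
      refine @measurable_pi_lambda _ _ _ pathPast _ _ fun a => measurable_pathPast_eval ?_
      have := a.2.2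
      omega
    have hZm : Measurable[pathPast] Z :=
      (((hCm i).comp (hpast i hij.le)).mul
        ((measurable_bit.comp (measurable_pathPast_eval (by omega))).sub
          (measurable_pathPast_condProbOne.comp (measurable_pathPast_translate (by omega))))).mul
        ((hCm j).comp (hpast j le_rfl))
    have hZ1 : ∀ x, |Z x| ≤ 1 := fun x => by
      rw [hZ, abs_mul, abs_mul]
      exact mul_le_one₀ (mul_le_one₀ (hC1 _ _) (abs_nonneg _) (abs_bit_sub_condProbOne_le _ _))
        (abs_nonneg _) (hC1 _ _)
    have hmZ : Measurable fun x => Z x * (bit (x 0) - condProbOne μ x) :=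
      (hZm.mono pathPast_le le_rfl).mul ((measurable_bit_eval 0).sub measurable_condProbOne)
    rw [← integral_mul_bit_sub_condProbOne (μ := μ) hZm hZ1, ← integral_comp_translate h j hmZ]
    refine integral_congr_ae (ae_of_all _ fun x => ?_)
    have e1 : translate (i - j) (translate j x) = translate i x := by
      ext a; simp only [translate]; congr 1; ring
    have e2 : translate j x (i - j) = x i := by simp [translate]
    have e3 : translate j x 0 = x j := by simp [translate]
    simp only [hZ, hd, translate_neg_translate, e1, e2, e3]
    ring
  have := ae_tendsto_sum_div_of_orthogonal (X := fun i => d (i + 1)) (fun i => hdm _)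
    (fun i => hd1 _) (fun i j hij => horth _ _ (by omega))
  filter_upwards [this] with x hx
  refine hx.congr fun n => ?_
  rw [sum_Icc_one_eq_sum_range (fun i => d i x)]

/-- The probability of a mistake when `1` is guessed with probability `c` and has probability `q`. -/
def mixedLoss (c q : ℝ) : ℝ := c + (1 - 2 * c) * q

/-- Splits the expected mistake into a fluctuation and, when q is the conditional probability of 1,
the conditional loss; the identity holds for every q. -/
theorem abs_sub_bit_eq {c : ℝ} (h0 : 0 ≤ c) (h1 : c ≤ 1) (b : Bool) (q : ℝ) :
    |c - bit b| = (1 - 2 * c) * (bit b - q) + mixedLoss c q := by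
  cases b
  · simp [bit, mixedLoss, abs_of_nonneg h0]
  · rw [abs_of_nonpos (by simpa [bit] using h1)]
    simp [bit, mixedLoss]
    ring

/-- The loss is affine in c, with endpoint values q and 1 - q. -/
theorem min_le_mixedLoss {c q : ℝ} (h0 : 0 ≤ c) (h1 : c ≤ 1) : min q (1 - q) ≤ mixedLoss c q := by
  rw [mixedLoss]
  rcases le_total q (1 - q) with h | h
  · rw [min_eq_left h]; nlinarith
  · rw [min_eq_right h]; nlinarith

/-- The loss of the optimal guess given the infinite past. -/
def bayesLoss (μ : Measure (ℤ → Bool)) (x : ℤ → Bool) : ℝ :=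
  min (condProbOne μ x) (1 - condProbOne μ x)

theorem measurable_bayesLoss : Measurable (bayesLoss μ) :=
  measurable_condProbOne.min (measurable_condProbOne.const_sub 1)

theorem integrable_bayesLoss [IsProbabilityMeasure μ] : Integrable (bayesLoss μ) μ :=
  integrable_condProbOne.inf ((integrable_const 1).sub integrable_condProbOne)

/-- No strategy is asymptotically better than the Bayes error. -/
theorem ae_eventually_integral_bayesLoss_sub_le [IsProbabilityMeasure μ] (h : Ergodic shift μ)
    {C : ∀ n, Past n → ℝ} (h0 : ∀ n y, 0 ≤ C n y) (h1 : ∀ n y, C n y ≤ 1) :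
    ∀ᵐ x ∂μ, ∀ ε > 0, ∀ᶠ n : ℕ in atTop, ∫ x, bayesLoss μ x ∂μ - ε <
      (∑ i ∈ Finset.Icc 1 n, |C i (past (forward x) i) - bit (x i)|) / n := by
  filter_upwards [ae_tendsto_sum_martingaleDifference_div h.toMeasurePreserving h0 h1,
    ae_tendsto_sum_translate_div h measurable_bayesLoss integrable_bayesLoss] with x hx1 hx2 ε hε
  have h3 := hx1.add hx2
  rw [zero_add] at h3
  filter_upwards [h3.eventually (lt_mem_nhds (sub_lt_self _ hε))] with n hn
  refine hn.trans_le ?_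
  rw [← add_div, ← Finset.sum_add_distrib]
  gcongr with i _
  rw [abs_sub_bit_eq (h0 _ _) (h1 _ _) (x i) (condProbOne μ (translate i x))]
  exact add_le_add_right (min_le_mixedLoss (h0 _ _) (h1 _ _)) _

/-- A strategy that eventually incurs at most the conditional loss `f` is asymptotically
no worse than the mean of `f`. -/
theorem ae_eventually_le_integral_add [IsProbabilityMeasure μ] (h : Ergodic shift μ)
    {C : ∀ n, Past n → ℝ} (h0 : ∀ n y, 0 ≤ C n y) (h1 : ∀ n y, C n y ≤ 1)
    {f : (ℤ → Bool) → ℝ} (hf : Measurable f) (hi : Integrable f μ)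
    (hle : ∀ᵐ x ∂μ, ∀ᶠ n : ℕ in atTop,
      mixedLoss (C n (past (forward x) n)) (condProbOne μ (translate n x)) ≤ f (translate n x)) :
    ∀ᵐ x ∂μ, ∀ ε > 0, ∀ᶠ n : ℕ in atTop,
      (∑ i ∈ Finset.Icc 1 n, |C i (past (forward x) i) - bit (x i)|) / n < ∫ x, f x ∂μ + ε := by
  filter_upwards [ae_tendsto_sum_martingaleDifference_div h.toMeasurePreserving h0 h1,
    ae_tendsto_sum_translate_div h hf hi, hle] with x hx1 hx2 hx3 ε hε
  -- Taking the maximum with f dominates the conditional loss in every round, yet changes only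
  -- finitely many terms of the average of f.
  have h4 : Tendsto (fun n : ℕ => (∑ i ∈ Finset.Icc 1 n,
      max (mixedLoss (C i (past (forward x) i)) (condProbOne μ (translate i x)))
        (f (translate i x))) / n) atTop (𝓝 (∫ x, f x ∂μ)) :=
    tendsto_sum_Icc_div_congr (hx3.mono fun i hi => max_eq_right hi) hx2
  have h5 := hx1.add h4
  rw [zero_add] at h5
  filter_upwards [h5.eventually (gt_mem_nhds (lt_add_of_pos_right _ hε))] with n hn
  refine lt_of_le_of_lt ?_ hn
  rw [← add_div, ← Finset.sum_add_distrib]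
  gcongr with i _
  rw [abs_sub_bit_eq (h0 _ _) (h1 _ _) (x i) (condProbOne μ (translate i x))]
  exact add_le_add_right (le_max_left _ _) _

end PathSpace

end SeqPred

end

noncomputable section

namespace SeqPred

/-! ### Consistency of the Markov experts and convergence of the expected loss. -/

section ExpertConsistency

variable {μ : Measure (ℤ → Bool)}

/-- The σ-algebra generated by the last `k` coordinates with negative index. -/
abbrev blockSigma (k : ℕ) : MeasurableSpace (ℤ → Bool) :=
  MeasurableSpace.comap (lastBlock k) MeasurableSpace.pi

theorem blockSigma_le (k : ℕ) : blockSigma k ≤ MeasurableSpace.pi :=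
  (measurable_lastBlock k).comap_le

/-- The filtration generated by longer and longer blocks of past coordinates. -/
def blockFiltration : Filtration ℕ (MeasurableSpace.pi : MeasurableSpace (ℤ → Bool)) where
  seq := blockSigma
  mono' := by
    intro k l hkl
    refine measurable_iff_comap_le.1 ?_
    have : lastBlock k = (fun b (j : Fin k) => b ⟨l - k + j, by omega⟩) ∘ lastBlock l := by
      ext x j
      simp only [lastBlock, Function.comp_apply]
      congr 1
      push_cast [Nat.cast_sub hkl]
      ring
    rw [this]
    exact (measurable_of_finite _).comp (comap_measurable _)
  le' := blockSigma_le

theorem iSup_blockFiltration : ⨆ k, blockFiltration k = pathPast := by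
  refine le_antisymm (iSup_le fun k => measurable_iff_comap_le.1 ?_) (iSup_le fun i => ?_)
  · exact @measurable_pi_lambda _ _ _ pathPast _ _ fun j =>
      measurable_pathPast_eval (by have := j.2; omega)
  · obtain ⟨i, hi⟩ := i
    obtain ⟨k, rfl⟩ : ∃ k : ℕ, i = -((k : ℤ) + 1) := ⟨(-i - 1).toNat, by omega⟩
    refine le_trans (measurable_iff_comap_le.1 ?_) (le_iSup _ (k + 1))
    have : (fun x : ℤ → Bool => x (-((k : ℤ) + 1))) = (fun b => b 0) ∘ lastBlock (k + 1) := by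
      ext x
      simp [lastBlock]
    change Measurable[blockSigma (k + 1)] fun x : ℤ → Bool => x (-((k : ℤ) + 1))
    rw [this]
    exact (measurable_of_finite _).comp (comap_measurable _)

/-- Gives the conditional probability a value at each string, to be compared with the empirical
frequency after that string. -/
theorem exists_condExp_blockSigma_eq (μ : Measure (ℤ → Bool)) (k : ℕ) :
    ∃ f : (Fin k → Bool) → ℝ, μ[fun x => bit (x 0) | blockSigma k] = f ∘ lastBlock k := by
  obtain ⟨f, -, hf⟩ := Measurable.exists_eq_measurable_comp
    (stronglyMeasurable_condExp (μ := μ) (m := blockSigma k) (f := fun x => bit (x 0))).measurable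
  exact ⟨f, hf⟩

theorem integrable_abs_condExp_sub [IsProbabilityMeasure μ] {k : ℕ} {f : (Fin k → Bool) → ℝ}
    (hf : μ[fun x => bit (x 0) | blockSigma k] = f ∘ lastBlock k) :
    Integrable (fun x => |f (lastBlock k x) - condProbOne μ x|) μ := by
  have h : Integrable (f ∘ lastBlock k) μ := hf ▸ integrable_condExp
  exact (h.sub integrable_condProbOne).abs

/-- Lévy's upward theorem for the conditional probabilities given finite blocks. -/
theorem tendsto_integral_abs_condExp_sub [IsProbabilityMeasure μ] {f : ∀ k, (Fin k → Bool) → ℝ}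
    (hf : ∀ k, μ[fun x => bit (x 0) | blockSigma k] = f k ∘ lastBlock k) :
    Tendsto (fun k => ∫ x, |f k (lastBlock k x) - condProbOne μ x| ∂μ) atTop (𝓝 0) := by
  have h := tendsto_eLpNorm_condExp (μ := μ) (ℱ := blockFiltration) fun x => bit (x 0)
  rw [iSup_blockFiltration] at h
  have h' := (ENNReal.tendsto_toReal ENNReal.zero_ne_top).comp h
  refine h'.congr fun k => ?_
  rw [Function.comp_apply, eLpNorm_one_eq_lintegral_enorm, ← integral_norm_eq_lintegral_enorm]
  · refine integral_congr_ae ?_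
    filter_upwards [condProbOne_ae_eq (μ := μ)] with x hx
    rw [Pi.sub_apply, Real.norm_eq_abs, ← hx]
    have : blockFiltration k = blockSigma k := rfl
    rw [this, hf]
    rfl
  · exact (integrable_condExp.sub integrable_condExp).aestronglyMeasurable

theorem block_past_forward (x : ℤ → Bool) {k i n : ℕ} (hk : k < i) (hi : i ≤ n) :
    (past (forward x) n).block k i hk hi = lastBlock k (translate i x) := by
  ext j
  simp only [Past.block, past, forward, lastBlock, translate]
  congr 1
  push_cast [Nat.cast_sub hk.le]
  ring

theorem card_filter_Ico_one {n : ℕ} (p : ℕ → Prop) [DecidablePred p] :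
    ((Finset.univ.filter fun i : Set.Ico 1 (n + 1) => p i).card : ℝ) =
      ∑ i ∈ Finset.Icc 1 n, if p i then (1 : ℝ) else 0 := by
  rw [Finset.sum_boole]
  congr 1
  refine Finset.card_bij (fun i _ => (i : ℕ)) ?_ (fun i _ j _ hij => Subtype.ext hij) ?_
  · intro i hi
    rw [Finset.mem_filter] at hi ⊢
    exact ⟨Finset.mem_Icc.2 ⟨i.2.1, Nat.lt_succ_iff.1 i.2.2⟩, hi.2⟩
  · intro j hj
    rw [Finset.mem_filter, Finset.mem_Icc] at hj
    exact ⟨⟨j, hj.1.1, Nat.lt_succ_iff.2 hj.1.2⟩, by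
      rw [Finset.mem_filter]; exact ⟨Finset.mem_univ _, hj.2⟩, rfl⟩

theorem countBlock_past_forward (x : ℤ → Bool) (k n : ℕ) (s : Fin k → Bool) :
    (countBlock k (past (forward x) (n + 1)) s : ℝ) =
      ∑ i ∈ Finset.Icc 1 n, if k < i ∧ lastBlock k (translate i x) = s then (1 : ℝ) else 0 := by
  rw [← card_filter_Ico_one, countBlock]
  congr 2
  ext i
  simp only [Finset.mem_filter, Finset.mem_univ, true_and]
  rw [← exists_prop]
  refine exists_congr fun hk => ?_
  rw [block_past_forward]

theorem countBlockBit_past_forward (x : ℤ → Bool) (k n : ℕ) (b : Bool) (s : Fin k → Bool) :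
    (countBlockBit k b (past (forward x) (n + 1)) s : ℝ) =
      ∑ i ∈ Finset.Icc 1 n,
        if (k < i ∧ lastBlock k (translate i x) = s) ∧ x i = b then (1 : ℝ) else 0 := by
  rw [← card_filter_Ico_one, countBlockBit]
  congr 2
  ext i
  simp only [Finset.mem_filter, Finset.mem_univ, true_and]
  refine and_congr ?_ Iff.rfl
  rw [← exists_prop]
  refine exists_congr fun hk => ?_
  rw [block_past_forward]

theorem measurableSet_lastBlock_eq (k : ℕ) (s : Fin k → Bool) :
    MeasurableSet {x | lastBlock k x = s} :=
  measurable_lastBlock k (measurableSet_singleton s)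

theorem ae_tendsto_countBlock_div [IsProbabilityMeasure μ] (h : Ergodic shift μ) (k : ℕ)
    (s : Fin k → Bool) :
    ∀ᵐ x ∂μ, Tendsto (fun n : ℕ => (countBlock k (past (forward x) (n + 1)) s : ℝ) / n) atTop
      (𝓝 (μ.real {x | lastBlock k x = s})) := by
  have hA := measurableSet_lastBlock_eq k s
  have hb := ae_tendsto_sum_translate_div h (measurable_const.indicator (f := fun _ => (1 : ℝ)) hA)
    ((integrable_const 1).indicator hA)
  rw [integral_indicator_const _ hA, smul_eq_mul, mul_one] at hb
  filter_upwards [hb] with x hx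
  simp_rw [countBlock_past_forward]
  refine tendsto_sum_Icc_div_congr ?_ hx
  filter_upwards [eventually_gt_atTop k] with i hi
  simp [Set.indicator, hi]

/-- Birkhoff for the event "block s, then 0", whose probability is computed from the defining
property of conditional expectation. The constraint k < i affects finitely many terms. -/
theorem ae_tendsto_countBlockBit_div [IsProbabilityMeasure μ] (h : Ergodic shift μ) {k : ℕ}
    {f : (Fin k → Bool) → ℝ} (hf : μ[fun x => bit (x 0) | blockSigma k] = f ∘ lastBlock k)
    (s : Fin k → Bool) :
    ∀ᵐ x ∂μ, Tendsto
      (fun n : ℕ => (countBlockBit k false (past (forward x) (n + 1)) s : ℝ) / n) atTop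
      (𝓝 ((1 - f s) * μ.real {x | lastBlock k x = s})) := by
  have hA := measurableSet_lastBlock_eq k s
  have hm : Measurable fun x : ℤ → Bool => 1 - bit (x 0) := (measurable_bit_eval 0).const_sub 1
  have hi : Integrable (fun x : ℤ → Bool => 1 - bit (x 0)) μ :=
    (integrable_const 1).sub (integrable_bit_eval 0)
  have hb := ae_tendsto_sum_translate_div h (hm.indicator hA) (hi.indicator hA)
  have hint : ∫ x, {x | lastBlock k x = s}.indicator (fun x => 1 - bit (x 0)) x ∂μ =
      (1 - f s) * μ.real {x | lastBlock k x = s} := by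
    have h1 : ∫ x in {x | lastBlock k x = s}, bit (x 0) ∂μ =
        f s * μ.real {x | lastBlock k x = s} := by
      have hAk : MeasurableSet[blockSigma k] {x | lastBlock k x = s} :=
        ⟨{s}, measurableSet_singleton s, rfl⟩
      rw [← setIntegral_condExp (blockSigma_le k) (integrable_bit_eval 0) hAk, hf]
      rw [setIntegral_congr_fun (g := fun _ => f s) hA fun x hx => by
        simp only [Function.comp_apply]; rw [show lastBlock k x = s from hx]]
      rw [setIntegral_const, smul_eq_mul, mul_comm]
    rw [integral_indicator hA, integral_sub (integrable_const 1).integrableOn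
      (integrable_bit_eval 0).integrableOn, h1, setIntegral_const, smul_eq_mul]
    ring
  rw [hint] at hb
  filter_upwards [hb] with x hx
  simp_rw [countBlockBit_past_forward]
  refine tendsto_sum_Icc_div_congr ?_ hx
  filter_upwards [eventually_gt_atTop k] with i hi
  have : translate i x 0 = x i := by simp [translate]
  by_cases hs : lastBlock k (translate i x) = s <;> cases hxi : x i <;>
    simp [Set.indicator, hi, hs, this, hxi, bit]

theorem ae_tendsto_freq [IsProbabilityMeasure μ] (h : Ergodic shift μ) {k : ℕ}
    {f : (Fin k → Bool) → ℝ} (hf : μ[fun x => bit (x 0) | blockSigma k] = f ∘ lastBlock k)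
    {s : Fin k → Bool} (hs : μ {x | lastBlock k x = s} ≠ 0) :
    ∀ᵐ x ∂μ, Tendsto (fun n : ℕ => freq k false (past (forward x) n) s) atTop (𝓝 (1 - f s)) := by
  have hpos : 0 < μ.real {x | lastBlock k x = s} :=
    ENNReal.toReal_pos hs (measure_ne_top _ _)
  filter_upwards [ae_tendsto_countBlock_div h k s, ae_tendsto_countBlockBit_div h hf s]
    with x h1 h2
  have h3 := h2.div h1 hpos.ne'
  rw [mul_div_cancel_right₀ _ hpos.ne'] at h3
  rw [← tendsto_add_atTop_iff_nat 1]
  refine h3.congr' ?_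
  -- Positive mass of s makes its count eventually nonzero, so the default value 1/2 is no longer
  -- used.
  filter_upwards [h1.eventually (lt_mem_nhds hpos), eventually_gt_atTop k] with n hn hkn
  have hn0 : (n : ℝ) ≠ 0 := by
    have : 0 < n := by omega
    positivity
  have hc : countBlock k (past (forward x) (n + 1)) s ≠ 0 := fun hc => by
    simp [hc] at hn
  rw [Pi.div_apply, freq, if_pos ⟨by omega, hc⟩, div_div_div_cancel_right₀ hn0]

/-- There are finitely many strings: null ones a.s. never occur, and for the others the frequency
settles on the side of 1/2 dictated by f. At f s = 1/2 the expert may oscillate, but both guesses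
are optimal. -/
theorem ae_eventually_expert [IsProbabilityMeasure μ] (h : Ergodic shift μ) {k : ℕ}
    {f : (Fin k → Bool) → ℝ} (hf : μ[fun x => bit (x 0) | blockSigma k] = f ∘ lastBlock k) :
    ∀ᵐ x ∂μ, ∀ᶠ n : ℕ in atTop,
      expert k n (past (forward x) n) = true ∧ 1 / 2 ≤ f (lastBlock k (translate n x)) ∨
      expert k n (past (forward x) n) = false ∧ f (lastBlock k (translate n x)) ≤ 1 / 2 := by
  have key : ∀ s : Fin k → Bool, ∀ᵐ x ∂μ, ∀ᶠ n : ℕ in atTop, lastBlock k (translate n x) = s →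
      expert k n (past (forward x) n) = true ∧ 1 / 2 ≤ f s ∨
      expert k n (past (forward x) n) = false ∧ f s ≤ 1 / 2 := by
    intro s
    by_cases hs : μ {x | lastBlock k x = s} = 0
    · have h0 : ∀ᵐ x ∂μ, lastBlock k x ≠ s := by
        simpa [ae_iff] using hs
      have h1 : ∀ᵐ x ∂μ, ∀ n : ℕ, lastBlock k (translate n x) ≠ s := ae_all_iff.2 fun n =>
        (measurePreserving_translate h.toMeasurePreserving n).quasiMeasurePreserving.ae h0
      filter_upwards [h1] with x hx
      exact Eventually.of_forall fun n hn => absurd hn (hx n)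
    · filter_upwards [ae_tendsto_freq h hf hs] with x hx
      have hexp : ∀ n, k < n → lastBlock k (translate n x) = s →
          expert k n (past (forward x) n) =
            if freq k false (past (forward x) n) s > 1 / 2 then false else true := by
        intro n hn hb
        rw [expert, dif_pos hn, block_past_forward, hb]
      rcases lt_trichotomy (f s) (1 / 2) with hlt | heq | hgt
      · filter_upwards [eventually_gt_atTop k,
          hx.eventually (lt_mem_nhds (by linarith : 1 / 2 < 1 - f s))] with n hn hfr hb
        exact Or.inr ⟨by rw [hexp n hn hb, if_pos hfr], hlt.le⟩
      · refine Eventually.of_forall fun n _ => ?_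
        cases expert k n (past (forward x) n)
        · exact Or.inr ⟨rfl, heq.le⟩
        · exact Or.inl ⟨rfl, heq.ge⟩
      · filter_upwards [eventually_gt_atTop k,
          hx.eventually (gt_mem_nhds (by linarith : 1 - f s < 1 / 2))] with n hn hfr hb
        exact Or.inl ⟨by rw [hexp n hn hb, if_neg hfr.le.not_gt], hgt.le⟩
  filter_upwards [ae_all_iff.2 key] with x hx
  filter_upwards [eventually_all.2 hx] with n hn
  exact hn _ rfl

/-- The asymptotic loss of the `k`-th order Markov expert exceeds the Bayes error by at most twice
the mean error made by forgetting all but the last `k` bits. -/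
theorem ae_eventually_detLoss_expert_lt [IsProbabilityMeasure μ] (h : Ergodic shift μ) {k : ℕ}
    {f : (Fin k → Bool) → ℝ} (hf : μ[fun x => bit (x 0) | blockSigma k] = f ∘ lastBlock k) :
    ∀ᵐ x ∂μ, ∀ ε > 0, ∀ᶠ n : ℕ in atTop, detLoss (expert k) (forward x) 1 n <
      ∫ x, bayesLoss μ x ∂μ + 2 * ∫ x, |f (lastBlock k x) - condProbOne μ x| ∂μ + ε := by
  have hi := integrable_abs_condExp_sub hf
  have hm : Measurable fun x => |f (lastBlock k x) - condProbOne μ x| :=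
    (((measurable_of_finite f).comp (measurable_lastBlock k)).sub measurable_condProbOne).abs
  have hle : ∀ᵐ x ∂μ, ∀ᶠ n : ℕ in atTop,
      mixedLoss (bit (expert k n (past (forward x) n))) (condProbOne μ (translate n x)) ≤
        bayesLoss μ (translate n x) + 2 * |f (lastBlock k (translate n x)) -
          condProbOne μ (translate n x)| := by
    filter_upwards [ae_eventually_expert h hf] with x hx
    filter_upwards [hx] with n hn
    have h1 := le_abs_self (f (lastBlock k (translate n x)) - condProbOne μ (translate n x))
    have h2 := neg_abs_le (f (lastBlock k (translate n x)) - condProbOne μ (translate n x))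
    rw [mixedLoss, bayesLoss, ← sub_le_iff_le_add]
    -- With q the true probability, a guess of 1 with f ≥ 1/2 costs 1 - q = q + (1 - 2q) ≤ q + 2(f -
    -- q); a guess of 0 is symmetric. Hence the factor 2.
    refine le_min ?_ ?_ <;> rcases hn with ⟨he, hfs⟩ | ⟨he, hfs⟩ <;> simp [he, bit] <;> linarith
  have := ae_eventually_le_integral_add h (C := fun n y => bit (expert k n y))
    (fun n y => bit_nonneg _) (fun n y => bit_le_one _)
    (measurable_bayesLoss.add (hm.const_mul 2)) (integrable_bayesLoss.add (hi.const_mul 2)) hle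
  simp_rw [Pi.add_apply] at this
  rw [integral_add integrable_bayesLoss (hi.const_mul 2), integral_const_mul] at this
  filter_upwards [this] with x hx ε hε
  filter_upwards [hx ε hε] with n hn
  rw [detLoss, avgMistakes_one]
  simpa only [mistake_eq_abs, forward] using hn

theorem tendsto_regret_bound (c : ℝ) :
    Tendsto (fun n : ℕ => c * Real.sqrt ((Real.logb 2 (n : ℝ) + 1) / n)) atTop (𝓝 0) := by
  have h1 : Tendsto (fun n : ℕ => Real.log (n : ℝ) / n) atTop (𝓝 0) :=
    Real.isLittleO_log_id_atTop.tendsto_div_nhds_zero.comp tendsto_natCast_atTop_atTop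
  have h2 := ((h1.div_const (Real.log 2)).add tendsto_one_div_atTop_nhds_zero_nat).sqrt.const_mul c
  rw [zero_div, zero_add, Real.sqrt_zero, mul_zero] at h2
  refine h2.congr fun n => ?_
  rw [Real.logb, add_div, div_right_comm]

/-- The expected loss of the predictor converges to the Bayes error. -/
theorem ae_tendsto_expectedLoss_predictor [IsProbabilityMeasure μ] (h : Ergodic shift μ) :
    ∀ᵐ x ∂μ, Tendsto (fun n : ℕ => expectedLoss predictor (forward x) 1 n) atTop
      (𝓝 (∫ x, bayesLoss μ x ∂μ)) := by
  choose f hf using exists_condExp_blockSigma_eq μ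
  have hlim := tendsto_integral_abs_condExp_sub hf
  filter_upwards [ae_eventually_integral_bayesLoss_sub_le h (C := fun n y => mixture y)
    (fun n y => mixture_nonneg y) (fun n y => mixture_le_one y),
    ae_all_iff.2 fun k => ae_eventually_detLoss_expert_lt h (hf k)] with x hx1 hx2
  rw [Metric.tendsto_nhds]
  intro ε hε
  -- The approximation error enters doubled, so ε/6 here leaves ε/3 each for the expert's
  -- convergence and the regret.
  obtain ⟨k, hk, hk1⟩ := ((hlim.eventually (gt_mem_nhds (by positivity : 0 < ε / 6))).and
    (eventually_ge_atTop 1)).exists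
  filter_upwards [hx1 ε hε, hx2 k (ε / 3) (by positivity), eventually_ge_atTop 1,
    (tendsto_regret_bound (Real.sqrt (Real.log 2) / (Real.sqrt 2 - 1))).eventually
      (gt_mem_nhds (by positivity : 0 < ε / 3))] with n h1 h2 hn h3
  have h4 := expectedLoss_predictor_le (forward x) hn hk1
  rw [Real.dist_eq, abs_lt]
  constructor
  · rw [expectedLoss_predictor]
    have : ∀ i, bit (forward x i) = bit (x i) := fun _ => rfl
    simp_rw [this]
    linarith
  · linarith

end ExpertConsistency

end SeqPred

end

noncomputable section

namespace SeqPred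

/-! ### From expected loss to actual randomized loss. -/

section Randomization

/-- The average number of mistakes of the predictor at the times `1, …, n`, where `v i` is the
randomizing variable of round `i + 1`. -/
def randomizedLoss (y : ℕ → Bool) (v : ℕ → unitInterval) (n : ℕ) : ℝ :=
  (∑ i ∈ Finset.range n, mistake (predictor (i + 1) (past y (i + 1)) (v i)) (y (i + 1))) / n

theorem loss_predictor_eq (y : ℕ → Bool) (u : ℕ → unitInterval) (n : ℕ) :
    loss predictor y u 1 n = randomizedLoss y (fun i => u (i + 1)) n := by
  rw [loss, avgMistakes_one, sum_Icc_one_eq_sum_range]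
  rfl

/-- The law of a sequence of independent uniformly distributed random variables. -/
abbrev uniformSeq : Measure (ℕ → unitInterval) :=
  Measure.infinitePi fun _ : ℕ => (volume : Measure unitInterval)

theorem abs_abs_mixture_sub_bit_le {n : ℕ} (y : Past n) (b : Bool) (u : unitInterval) :
    |mistake (predictor n y u) b - (|mixture y - bit b|)| ≤ 1 := by
  have h0 := mixture_nonneg y
  have h1 := mixture_le_one y
  have h2 : |mixture y - bit b| ≤ 1 := by
    rw [abs_le]
    have := bit_nonneg b
    have := bit_le_one b
    constructor <;> linarith
  have h3 := abs_nonneg (mixture y - bit b)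
  have h4 : 0 ≤ mistake (predictor n y u) b := by rw [mistake]; split_ifs <;> norm_num
  have h5 := (le_abs_self _).trans (abs_mistake_le_one (predictor n y u) b)
  rw [abs_le]
  constructor <;> linarith

/-- For fixed y the centred mistakes are independent, hence orthogonal, and bounded by 1, so the
strong law applies. -/
theorem ae_tendsto_randomizedLoss_sub (y : ℕ → Bool) :
    ∀ᵐ v ∂uniformSeq, Tendsto
      (fun n : ℕ => randomizedLoss y v n - expectedLoss predictor y 1 n) atTop (𝓝 0) := by
  set X : ℕ → unitInterval → ℝ := fun i u =>
    mistake (predictor (i + 1) (past y (i + 1)) u) (y (i + 1)) -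
      |mixture (past y (i + 1)) - bit (y (i + 1))| with hX
  have hXm : ∀ i, Measurable (X i) := fun i => (measurable_mistake_predictor _ _).sub_const _
  have hXv : ∀ i, Measurable fun v : ℕ → unitInterval => X i (v i) := fun i =>
    (hXm i).comp (measurable_pi_apply i)
  have hX0 : ∀ i, ∫ v, X i (v i) ∂uniformSeq = 0 := fun i => by
    simp only [hX]
    rw [integral_sub _ (integrable_const _), integral_mistake_predictor_infinitePi]
    · simp
    · exact Integrable.of_bound ((measurable_mistake_predictor _ _).comp
        (measurable_pi_apply i)).aestronglyMeasurable 1 (ae_of_all _ fun u => abs_mistake_le_one _ _)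
  have := ae_tendsto_sum_div_of_orthogonal (P := uniformSeq)
    (X := fun i v => X i (v i)) hXv (fun i v => abs_abs_mixture_sub_bit_le _ _ _)
    (fun i j hij => by
      have hind := (iIndepFun_infinitePi (P := fun _ : ℕ => (volume : Measure unitInterval))
        hXm).indepFun hij.ne
      rw [hind.integral_fun_mul_eq_mul_integral (hXv i).aestronglyMeasurable
        (hXv j).aestronglyMeasurable, hX0 i, zero_mul])
  filter_upwards [this] with v hv
  refine hv.congr fun n => ?_
  rw [randomizedLoss, expectedLoss_predictor, sum_Icc_one_eq_sum_range, ← sub_div,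
    ← Finset.sum_sub_distrib]

theorem measurable_randomizedLoss (n : ℕ) :
    Measurable fun p : (ℤ → Bool) × (ℕ → unitInterval) =>
      randomizedLoss (forward p.1) p.2 n := by
  refine Measurable.div_const (Finset.measurable_sum _ fun i _ => ?_) _
  simp_rw [mistake_predictor_eq]
  have hb : Measurable fun p : (ℤ → Bool) × (ℕ → unitInterval) => bit (forward p.1 (i + 1)) :=
    (measurable_bit_eval ((i + 1 : ℕ) : ℤ)).comp measurable_fst
  have hmix : Measurable fun p : (ℤ → Bool) × (ℕ → unitInterval) =>
      mixture (past (forward p.1) (i + 1)) :=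
    (measurable_of_finite fun y : Past (i + 1) => mixture y).comp
      ((measurable_past_forward (i + 1)).comp measurable_fst)
  have hu : Measurable fun p : (ℤ → Bool) × (ℕ → unitInterval) => ((p.2 i : unitInterval) : ℝ) :=
    measurable_subtype_coe.comp ((measurable_pi_apply i).comp measurable_snd)
  exact hb.add (((hb.const_mul 2).const_sub 1).mul
    (Measurable.ite (measurableSet_le hu hmix) measurable_const measurable_const))

/-- Fubini: the randomization is averaged out with the sequence frozen, then the sequence is taken
typical. -/
theorem ae_prod_tendsto_randomizedLoss {μ : Measure (ℤ → Bool)} [IsProbabilityMeasure μ]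
    (h : Ergodic shift μ) :
    ∀ᵐ p ∂μ.prod uniformSeq, Tendsto (fun n : ℕ => randomizedLoss (forward p.1) p.2 n) atTop
      (𝓝 (∫ x, bayesLoss μ x ∂μ)) := by
  rw [Measure.ae_prod_iff_ae_ae (measurableSet_tendsto _ measurable_randomizedLoss)]
  filter_upwards [ae_tendsto_expectedLoss_predictor h] with x hx
  filter_upwards [ae_tendsto_randomizedLoss_sub (forward x)] with v hv
  simpa using hv.add hx

end Randomization

/-! ### Transfer from path space to an arbitrary probability space. -/

section Universality

theorem pastSigma_eq_comap {Ω : Type u} (Y : ℤ → Ω → Bool) :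
    pastSigma Y = MeasurableSpace.comap (fun ω i => Y i ω) pathPast := by
  rw [pathPast, pastSigma, pastSigma, MeasurableSpace.comap_iSup]
  simp_rw [MeasurableSpace.comap_comp]
  rfl

variable {Ω : Type u} [MeasurableSpace Ω] {P : Measure Ω} {Y : ℤ → Ω → Bool}

/-- The past σ-algebra on Ω is the pullback of the one on path space, so a change of variables
verifies the defining integral identities. -/
theorem condExp_pastSigma_ae_eq [IsProbabilityMeasure P] (hY : ∀ i, Measurable (Y i)) :
    P⟦Y 0 ⁻¹' {true} | pastSigma Y⟧ =ᵐ[P]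
      fun ω => condProbOne (P.map fun ω i => Y i ω) fun i => Y i ω := by
  have hYm : Measurable fun ω (i : ℤ) => Y i ω := measurable_pi_lambda _ hY
  set μ := P.map fun ω (i : ℤ) => Y i ω with hμ
  have : IsProbabilityMeasure μ := Measure.isProbabilityMeasure_map hYm.aemeasurable
  have hA : MeasurableSet (Y 0 ⁻¹' {true}) := hY 0 (measurableSet_singleton _)
  have hle : pastSigma Y ≤ ‹MeasurableSpace Ω› := iSup_le fun i => (hY i).comap_le
  have hqi : Integrable (fun ω => condProbOne μ fun i => Y i ω) P :=
    (hYm.measurePreserving P).integrable_comp_of_integrable integrable_condProbOne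
  refine (ae_eq_condExp_of_forall_setIntegral_eq hle ((integrable_const 1).indicator hA)
    (fun s _ _ => hqi.integrableOn) (fun s hs _ => ?_) ?_).symm
  · rw [pastSigma_eq_comap] at hs
    obtain ⟨t, ht, rfl⟩ := hs
    have ht' := pathPast_le t ht
    calc ∫ ω in (fun ω (i : ℤ) => Y i ω) ⁻¹' t, condProbOne μ (fun i => Y i ω) ∂P
        = ∫ x in t, condProbOne μ x ∂μ :=
          (setIntegral_map ht' measurable_condProbOne.aestronglyMeasurable hYm.aemeasurable).symm
      _ = ∫ x in t, (μ[fun x => bit (x 0) | pathPast]) x ∂μ :=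
          integral_congr_ae (ae_restrict_of_ae condProbOne_ae_eq)
      _ = ∫ x in t, bit (x 0) ∂μ := setIntegral_condExp pathPast_le (integrable_bit_eval 0) ht
      _ = ∫ ω in (fun ω (i : ℤ) => Y i ω) ⁻¹' t, bit (Y 0 ω) ∂P :=
          setIntegral_map ht' (measurable_bit_eval 0).aestronglyMeasurable hYm.aemeasurable
      _ = _ := by
          refine integral_congr_ae (ae_of_all _ fun ω => ?_)
          simp [Set.indicator, bit]
  · have hm : Measurable[pastSigma Y] fun ω => condProbOne μ fun i => Y i ω := by
      rw [pastSigma_eq_comap]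
      exact measurable_pathPast_condProbOne.comp (comap_measurable _)
    exact hm.stronglyMeasurable.aestronglyMeasurable

theorem bayesError_eq [IsProbabilityMeasure P] (hY : ∀ i, Measurable (Y i)) :
    bayesError P Y =
      ∫ x, bayesLoss (P.map fun ω i => Y i ω) x ∂(P.map fun ω (i : ℤ) => Y i ω) := by
  have hYm : Measurable fun ω (i : ℤ) => Y i ω := measurable_pi_lambda _ hY
  have hA : MeasurableSet (Y 0 ⁻¹' {true}) := hY 0 (measurableSet_singleton _)
  have hle : pastSigma Y ≤ ‹MeasurableSpace Ω› := iSup_le fun i => (hY i).comap_le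
  have hcompl : (Y 0 ⁻¹' {false}).indicator (fun _ => (1 : ℝ)) =
      (fun _ => 1) - (Y 0 ⁻¹' {true}).indicator (fun _ => (1 : ℝ)) := by
    ext ω
    cases hω : Y 0 ω <;> simp [Set.indicator, hω]
  have hsub := condExp_sub (m := pastSigma Y) (integrable_const (μ := P) (1 : ℝ))
    ((integrable_const (μ := P) (1 : ℝ)).indicator hA)
  rw [condExp_const hle] at hsub
  rw [bayesError, hcompl, integral_map hYm.aemeasurable measurable_bayesLoss.aestronglyMeasurable]
  refine integral_congr_ae ?_
  filter_upwards [condExp_pastSigma_ae_eq (P := P) hY, hsub] with ω h1 h2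
  rw [h2, Pi.sub_apply, h1, bayesLoss]

theorem isUniversal_predictor : IsUniversal.{u} predictor := by
  intro Ω _ P _ Y U hY hU hind
  obtain ⟨hYm', herg⟩ := hY
  have hYm : Measurable fun ω (i : ℤ) => Y i ω := measurable_pi_lambda _ hYm'
  have hUm' : ∀ i, Measurable (U (i + 1)) := fun i => (hU.1 (i + 1) (by omega)).1
  have hUm : Measurable fun ω (i : ℕ) => U (i + 1) ω := measurable_pi_lambda _ hUm'
  have : IsProbabilityMeasure (P.map fun ω (i : ℤ) => Y i ω) :=
    Measure.isProbabilityMeasure_map hYm.aemeasurable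
  have hlawU : P.map (fun ω (i : ℕ) => U (i + 1) ω) = uniformSeq := by
    rw [hU.2.map_fun_eq_infinitePi_map hUm']
    congr 1
    ext1 i
    exact (hU.1 (i + 1) (by omega)).2
  -- Only the joint law of (Y, U) matters; independence makes it the product for which convergence
  -- is known.
  have hlaw := (indepFun_iff_map_prod_eq_prod_map_map hYm.aemeasurable hUm.aemeasurable).1 hind
  have h := ae_prod_tendsto_randomizedLoss herg
  rw [← hlawU, ← hlaw] at h
  filter_upwards [ae_of_ae_map (hYm.prodMk hUm).aemeasurable h] with ω hω
  rw [bayesError_eq hYm']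
  exact hω.congr fun n => (loss_predictor_eq _ _ n).symm

end Universality

end SeqPred

end

theorem theorem3 :
    SeqPred.IsUniversal.{u} SeqPred.predictor ∧
    ∀ (y : ℕ → Bool) (n : ℕ), 1 ≤ n → ∀ k : ℕ, 1 ≤ k →
      SeqPred.expectedLoss SeqPred.predictor y 1 n ≤
        SeqPred.detLoss (SeqPred.expert k) y 1 n +
          Real.sqrt (Real.log 2) / (Real.sqrt 2 - 1) *
            Real.sqrt ((Real.logb 2 (n : ℝ) + 1) / (n : ℝ)) :=
  ⟨SeqPred.isUniversal_predictor, fun y _ hn _ hk => SeqPred.expectedLoss_predictor_le y hn hk⟩
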